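/- Let $F_2=\langle a,b\rangle$ be the free group of rank two. An element of $F_2$ is primitive if it belongs to a generating pair of $F_2$; two elements $g,h$ lie in the same extended conjugacy class if $g$ is conjugate to $h$ or to $h^{-1}$. Let $\rho\colon F_2\to SL(2,\mathbb C)$ satisfy the BQ-conditions: $\rho$ is irreducible, $\operatorname{Tr}\rho(g)\notin[-2,2]$ for every primitive $g$, and only finitely many extended conjugacy classes of primitive elements $g$ satisfy $|\operatorname{Tr}\rho(g)|\le 2$. Write $U=\rho(u)$, $V=\rho(v)$, and let $\ell(X)=\inf_{P\in\mathbb H^3}d(P,XP)$ be the translation length of $X$ on hyperbolic space $\mathbb H^3$. A generating pair $(u,v)$ of $F_2$ is called positive if the reduced words of $u$ and $v$ in $a,b$ are cyclically reduced, all exponents of $a$ occurring in them are positive, and all exponents of $b$ occurring in the two words have one and the same sign. Let $\mathcal C(u,v)$ be the set of all non-empty cyclically shortest (that is, cyclically reduced in $u^{\pm1},v^{\pm1}$) words $w=e_1e_2\cdots e_n$ which are products of positive powers of $u$ and $v$ (so $e_k\in\{u,v\}$). For a basepoint $O\in\mathbb H^3$ and $E_k=\rho(e_k)$, the broken geodesic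 $\mathrm{br}_\rho(w;(u,v))$ is the bi-infinite path of geodesic segments with successive vertices $$\ldots,\ E_n^{-1}E_{n-1}^{-1}O,\ E_n^{-1}O,\ O,\ E_1O,\ E_1E_2O,\ \ldots,\ E_1\cdots E_nO,\ E_1\cdots E_nE_1O,\ \ldots$$ parametrised by $\mathbb R$ so that each segment is traversed at constant speed in unit time, with $O$ at time $0$. Then there is a constant $L_2>0$, depending only on $\rho$, such that for every positive generator pair $(u,v)$ with $\max\{\ell(U),\ell(V)\}>L_2$ the broken geodesics $\mathrm{br}_\rho(w;(u,v))$, $w\in\mathcal C(u,v)$, are uniformly quasigeodesic: for every basepoint $O$ there are $K,\epsilon>0$ such that for all $w\in\mathcal C(u,v)$ the path $\gamma=\mathrm{br}_\rho(w;(u,v))$ satisfies $$K^{-1}|s-t|-\epsilon\le d(\gamma(s),\gamma(t))\le K|s-t|+\epsilon\qquad\text{for all } s,t\in\mathbb R.$$ -/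

import Mathlib

/-! ### Hyperbolic 3-space, in the model of positive definite Hermitian matrices -/

open scoped ComplexOrder in
/-- Hyperbolic 3-space: positive definite Hermitian complex `2 × 2` matrices of determinant one.
The group `SL(2, ℂ)` acts by `g • P = g P gᴴ`, and the distance `d(P, Q)` of curvature `-1` is given
by `cosh d(P, Q) = tr (P⁻¹ Q) / 2`. -/
@[ext]
structure Hyp3 where
  /-- The matrix that represents the point. -/
  mat : Matrix (Fin 2) (Fin 2) ℂ
  posDef : mat.PosDef
  det_eq_one : mat.det = 1

namespace Hyp3

noncomputable section

open scoped ComplexOrder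

instance : Nonempty Hyp3 := ⟨⟨1, Matrix.PosDef.one, Matrix.det_one⟩⟩

instance : MulAction (Matrix.SpecialLinearGroup (Fin 2) ℂ) Hyp3 where
  smul g P := ⟨g.1 * P.mat * g.1.conjTranspose, by
      refine P.posDef.mul_mul_conjTranspose_same ?_
      refine Matrix.vecMul_injective_of_isUnit ?_
      rw [Matrix.isUnit_iff_isUnit_det, g.2]
      exact isUnit_one, by
      rw [Matrix.det_mul, Matrix.det_mul, Matrix.det_conjTranspose, g.2, P.det_eq_one]
      simp⟩
  one_smul P := by
    apply Hyp3.ext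
    change (1 : Matrix (Fin 2) (Fin 2) ℂ) * P.mat * (1 : Matrix (Fin 2) (Fin 2) ℂ).conjTranspose = P.mat
    simp
  mul_smul g h P := by
    apply Hyp3.ext
    change (g.1 * h.1) * P.mat * (g.1 * h.1).conjTranspose =
      g.1 * (h.1 * P.mat * h.1.conjTranspose) * g.1.conjTranspose
    rw [Matrix.conjTranspose_mul]
    simp only [Matrix.mul_assoc]

/-- The hyperbolic cosine of the distance of two points. -/
def coshDist (P Q : Hyp3) : ℝ := (P.mat⁻¹ * Q.mat).trace.re / 2

/-- The hyperbolic distance. -/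
def hdist (P Q : Hyp3) : ℝ := Real.arcosh (coshDist P Q)

theorem exists_entries (P : Hyp3) : ∃ (p r : ℝ) (q : ℂ),
    P.mat = !![(p : ℂ), q; star q, (r : ℂ)] ∧ 0 < p ∧ p * r = 1 + Complex.normSq q := by
  obtain ⟨P, hP, hd⟩ := P
  have h00 := hP.isHermitian.apply 0 0
  have h01 := hP.isHermitian.apply 1 0
  have h11 := hP.isHermitian.apply 1 1
  have hp : 0 < P 0 0 := hP.diag_pos
  have e0 : P 0 0 = ((P 0 0).re : ℂ) := (Complex.conj_eq_iff_re.mp h00).symm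
  have e1 : P 1 1 = ((P 1 1).re : ℂ) := (Complex.conj_eq_iff_re.mp h11).symm
  refine ⟨(P 0 0).re, (P 1 1).re, P 0 1, ?_, (Complex.pos_iff.mp hp).1, ?_⟩
  · ext i j
    fin_cases i <;> fin_cases j
    · exact e0
    · rfl
    · exact h01.symm
    · exact e1
  · rw [Matrix.det_fin_two, ← h01, e0, e1] at hd
    have := congrArg Complex.re hd
    simp at this
    rw [Complex.normSq_apply]
    linarith

theorem det_smul_add_smul (P Q : Hyp3) (x y : ℝ) :
    ((x : ℂ) • P.mat + (y : ℂ) • Q.mat).det =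
      ((x * x + y * y + 2 * x * y * coshDist P Q : ℝ) : ℂ) := by
  obtain ⟨p, r, q, hP, -, hpr⟩ := exists_entries P
  obtain ⟨p', r', q', hQ, -, hpr'⟩ := exists_entries Q
  have hd : P.mat.det = 1 := P.det_eq_one
  unfold coshDist
  rw [Matrix.inv_def, hd, hP, hQ, Matrix.adjugate_fin_two_of, Matrix.det_fin_two]
  rw [Complex.normSq_apply] at hpr hpr'
  apply Complex.ext
  · simp [Matrix.trace_fin_two]
    linear_combination x ^ 2 * hpr + y ^ 2 * hpr'
  · simp [Matrix.trace_fin_two]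
    ring

theorem one_le_coshDist (P Q : Hyp3) : 1 ≤ coshDist P Q := by
  obtain ⟨p, r, q, hP, hp, hpr⟩ := exists_entries P
  obtain ⟨p', r', q', hQ, hp', hpr'⟩ := exists_entries Q
  have hd : P.mat.det = 1 := P.det_eq_one
  have key : coshDist P Q = (r * p' + p * r' - 2 * (q.re * q'.re + q.im * q'.im)) / 2 := by
    unfold coshDist
    rw [Matrix.inv_def, hd, hP, hQ, Matrix.adjugate_fin_two_of]
    simp [Matrix.trace_fin_two]
    ring
  rw [Complex.normSq_apply] at hpr hpr'
  rw [key]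
  have h : 0 ≤ p * p' * (r * p' + p * r' - 2 * (q.re * q'.re + q.im * q'.im) - 2) := by
    have : p * p' * (r * p' + p * r' - 2 * (q.re * q'.re + q.im * q'.im) - 2) =
        (p - p') ^ 2 + (p * q'.re - p' * q.re) ^ 2 + (p * q'.im - p' * q.im) ^ 2 := by
      linear_combination p' ^ 2 * hpr + p ^ 2 * hpr'
    rw [this]
    positivity
  have := nonneg_of_mul_nonneg_right h (mul_pos hp hp')
  linarith

/-- The weight of the endpoint `Q` in the point at fraction `s` of a geodesic segment from `P` to `Q`
of length `d`. -/
def weight (d s : ℝ) : ℝ := if d = 0 then s else Real.sinh (s * d) / Real.sinh d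

theorem weight_nonneg {d s : ℝ} (hd : 0 ≤ d) (hs : 0 ≤ s) : 0 ≤ weight d s := by
  unfold weight
  split_ifs
  · exact hs
  · exact div_nonneg (Real.sinh_nonneg_iff.mpr (mul_nonneg hs hd)) (Real.sinh_nonneg_iff.mpr hd)

theorem det_weight (P Q : Hyp3) (s : ℝ) :
    ((weight (hdist P Q) (1 - s) : ℂ) • P.mat + (weight (hdist P Q) s : ℂ) • Q.mat).det = 1 := by
  have hc : coshDist P Q = Real.cosh (hdist P Q) :=
    (Real.cosh_arcosh (one_le_coshDist P Q)).symm
  rw [det_smul_add_smul, hc]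
  norm_cast
  unfold weight
  split_ifs with h
  · rw [h, Real.cosh_zero]
    ring
  · have hne : Real.sinh (hdist P Q) ≠ 0 := fun h' => h (Real.sinh_eq_zero.mp h')
    generalize hdist P Q = d at hne
    field_simp
    have e : d = (1 - s) * d + s * d := by ring
    have e1 : Real.sinh d = Real.sinh ((1 - s) * d + s * d) := by rw [← e]
    have e2 : Real.cosh d = Real.cosh ((1 - s) * d + s * d) := by rw [← e]
    rw [e1, e2, Real.sinh_add, Real.cosh_add]
    have c1 := Real.cosh_sq ((1 - s) * d)
    have c2 := Real.cosh_sq (s * d)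
    linear_combination (- Real.sinh (s * d) ^ 2) * c1 - Real.sinh ((1 - s) * d) ^ 2 * c2

theorem posDef_weight (P Q : Hyp3) {s : ℝ} (hs0 : 0 ≤ s) (hs1 : s ≤ 1) :
    ((weight (hdist P Q) (1 - s) : ℂ) • P.mat + (weight (hdist P Q) s : ℂ) • Q.mat).PosDef := by
  have hd : 0 ≤ hdist P Q := Real.arcosh_nonneg (one_le_coshDist P Q)
  have hpsd :
      ((weight (hdist P Q) (1 - s) : ℂ) • P.mat + (weight (hdist P Q) s : ℂ) • Q.mat).PosSemidef :=
    (P.posDef.posSemidef.smul (by exact_mod_cast weight_nonneg hd (by linarith))).add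
      (Q.posDef.posSemidef.smul (by exact_mod_cast weight_nonneg hd hs0))
  rw [hpsd.posDef_iff_isUnit, Matrix.isUnit_iff_isUnit_det, det_weight]
  exact isUnit_one

/-- The point at fraction `s` of the geodesic segment from `P` to `Q`, that is, the point of the
segment at distance `s * d(P, Q)` from `P`. -/
def segment (P Q : Hyp3) (s : Set.Icc (0 : ℝ) 1) : Hyp3 where
  mat := (weight (hdist P Q) (1 - s.1) : ℂ) • P.mat + (weight (hdist P Q) s.1 : ℂ) • Q.mat
  posDef := posDef_weight P Q s.2.1 s.2.2
  det_eq_one := det_weight P Q s.1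

/-- The translation length of `X`, the infimum of its displacements; for loxodromic `X` this is the
distance by which `X` translates its axis. -/
def translationLength (X : Matrix.SpecialLinearGroup (Fin 2) ℂ) : ℝ :=
  ⨅ P : Hyp3, hdist P (X • P)

/-- `γ` is a `(K, ε)`-quasigeodesic defined on the whole real line. -/
def IsQuasigeodesic (K ε : ℝ) (γ : ℝ → Hyp3) : Prop :=
  ∀ s t : ℝ, K⁻¹ * |s - t| - ε ≤ hdist (γ s) (γ t) ∧ hdist (γ s) (γ t) ≤ K * |s - t| + ε

end

end Hyp3

/-! ### The free group of rank two -/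

/-- The free group of rank two; its fixed generators are `a = of 0` and `b = of 1`. -/
abbrev F2 : Type := FreeGroup (Fin 2)

/-- The elements `u` and `v` generate the free group of rank two. -/
def IsGeneratorPair (u v : F2) : Prop := Subgroup.closure {u, v} = ⊤

/-- A primitive element is a member of a generating pair. -/
def IsPrimitiveElt (u : F2) : Prop := ∃ v, IsGeneratorPair u v

/-- Extended conjugacy: `u` is conjugate to `v` or to `v⁻¹`. -/
def extendedConj : Setoid F2 where
  r u v := IsConj u v ∨ IsConj u v⁻¹
  iseqv := by
    have hinv : ∀ {x y : F2}, IsConj x y → IsConj x⁻¹ y⁻¹ := by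
      intro x y h
      obtain ⟨c, hc⟩ := isConj_iff.mp h
      exact isConj_iff.mpr ⟨c, by rw [← hc]; group⟩
    refine ⟨fun _ => Or.inl (IsConj.refl _), ?_, ?_⟩
    · rintro x y (h | h)
      · exact Or.inl h.symm
      · exact Or.inr (by simpa using (hinv h).symm)
    · rintro x y z (h | h) (h' | h')
      · exact Or.inl (h.trans h')
      · exact Or.inr (h.trans h')
      · exact Or.inr (h.trans (hinv h'))
      · exact Or.inl (by simpa using h.trans (hinv h'))

/-- The element is cyclically shortest and all exponents of `a` in it are positive. -/
def IsPositiveElt (g : F2) : Prop :=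
  FreeGroup.IsCyclicallyReduced g.toWord ∧ ∀ x ∈ g.toWord, x.1 = 0 → x.2 = true

/-- A positive generator pair: a generating pair of positive elements, such that moreover all
exponents of `b` which occur in the two words have the same sign. The last clause only matters if
one of the elements is `b` or `b⁻¹`; it excludes pairs like `(ab, b⁻¹)`, for which the word length
is not additive on the product. -/
def IsPositivePair (u v : F2) : Prop :=
  IsGeneratorPair u v ∧ IsPositiveElt u ∧ IsPositiveElt v ∧
    ∃ σ : Bool, ∀ x ∈ u.toWord ++ v.toWord, x.1 = 1 → x.2 = σ

/-! ### Representations and broken geodesics -/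

/-- The representation on `ℂ²` given by a homomorphism to `SL(2, ℂ)`. -/
noncomputable def linearRep (ρ : F2 →* Matrix.SpecialLinearGroup (Fin 2) ℂ) :
    Representation ℂ F2 (Fin 2 → ℂ) where
  toFun g := Matrix.toLin' (ρ g).1
  map_one' := by simp [Module.End.one_eq_id]
  map_mul' g h := by simp [Matrix.toLin'_mul, Module.End.mul_eq_comp]

/-- The BQ-conditions: `ρ` is irreducible, no primitive element has trace in `[-2, 2]`, and there are
only finitely many extended conjugacy classes of primitive elements with trace of modulus at most
`2`. -/
def SatisfiesBQ (ρ : F2 →* Matrix.SpecialLinearGroup (Fin 2) ℂ) : Prop :=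
  (linearRep ρ).IsIrreducible ∧
  (∀ g, IsPrimitiveElt g → ∀ x ∈ Set.Icc (-2 : ℝ) 2, (ρ g).1.trace ≠ (x : ℂ)) ∧
  (Quotient.mk extendedConj '' {g | IsPrimitiveElt g ∧ ‖(ρ g).1.trace‖ ≤ 2}).Finite

/-- The element of `F₂` spelled by the word `w` in the letters `u = (0, true)`, `u⁻¹ = (0, false)`,
`v = (1, true)`, `v⁻¹ = (1, false)`. -/
def spell (u v : F2) (w : List (Fin 2 × Bool)) : F2 :=
  FreeGroup.lift ![u, v] (FreeGroup.mk w)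

/-- For `w = e₁ ⋯ eₙ`, the element `w ^ q * e₁ ⋯ eᵣ` where `k = q * n + r` with `0 ≤ r < n`. -/
def periodicPrefix (u v : F2) (w : List (Fin 2 × Bool)) (k : ℤ) : F2 :=
  spell u v w ^ (k / (w.length : ℤ)) * spell u v (w.take (k % (w.length : ℤ)).toNat)

/-- The vertices of the broken geodesic: `…, Eₙ⁻¹ O, O, E₁ O, E₁ E₂ O, …, E₁ ⋯ Eₙ E₁ O, …`, with
`O` in position `0`. -/
noncomputable def brokenVertex (ρ : F2 →* Matrix.SpecialLinearGroup (Fin 2) ℂ) (O : Hyp3) (u v : F2)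
    (w : List (Fin 2 × Bool)) (k : ℤ) : Hyp3 :=
  ρ (periodicPrefix u v w k) • O

/-- The broken geodesic of the word `w` in the generators `u`, `v`: the path which on each interval
`[k, k + 1]` runs at constant speed along the geodesic segment from vertex `k` to vertex `k + 1`. -/
noncomputable def brokenGeodesic (ρ : F2 →* Matrix.SpecialLinearGroup (Fin 2) ℂ) (O : Hyp3) (u v : F2)
    (w : List (Fin 2 × Bool)) (t : ℝ) : Hyp3 :=
  Hyp3.segment (brokenVertex ρ O u v w ⌊t⌋) (brokenVertex ρ O u v w (⌊t⌋ + 1))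
    ⟨Int.fract t, Int.fract_nonneg t, (Int.fract_lt_one t).le⟩

/-- The cyclically shortest nonempty words which are products of positive powers of the two
generators. -/
def positiveWords : Set (List (Fin 2 × Bool)) :=
  {w | w ≠ [] ∧ FreeGroup.IsCyclicallyReduced w ∧ ∀ x ∈ w, x.2 = true}

/-!
# Broken geodesics of long positive generating pairs

The key notion is that of an *expanding pair* `(A, B)` of matrices (`Hyp3.ExpandingPair`): both map
one cone in `ℂ²` into itself and expand a linear functional on it by a factor `κ > 1`. Geometrically,
the two Möbius transformations map a closed disc of the Riemann sphere into itself. Products of `n`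
matrices of an expanding pair then have norm at least `c κⁿ`, and as the displacement of a point is
the logarithm of the norm up to bounded error, broken geodesics of positive words are uniformly
quasigeodesic (`Hyp3.ExpandingPair.exists_isQuasigeodesic_brokenGeodesic`). Being expanding is
invariant under conjugation and exchange, and passes from `(u, v)` to `(u, uv)` and `(uv, v)`.

A positive pair is, up to conjugation and exchange, a descendant of `(a, b)` or `(a, b⁻¹)` under the
moves `(u, v) ↦ (u, uv)` and `(u, v) ↦ (uv, v)` (`isConjDescendant_of_isGeneratorPair`): rotating the
two words by their longest common prefix either exposes a suffix relation, which lets one shorten the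
pair, or leaves a pair of words which is Nielsen reduced, hence consists of single letters.

It remains to bound the translation lengths of the descendants that fail to be expanding. By König's
lemma and heredity it suffices that every infinite branch of the binary tree of descendants reaches an
expanding pair. The products along a branch are pairwise inequivalent primitive elements, so by the
BQ-conditions their traces eventually have modulus larger than two.

* If the branch is eventually constant, its pairs are conjugate to `(u vⁿ, v)`. In an eigenbasis of
  the loxodromic matrix of `v` the leading coefficient of the trace of `u vⁿ` cannot vanish, as these
  traces do not tend to zero, and for large `n` the criterion `Hyp3.ExpandingPair.of_diagonal` applies
  (`Hyp3.ExpandingPair.exists_mul_pow`).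
* Otherwise let `x`, `y`, `z` be the traces of `u`, `v`, `uv`, so that `x y - z` is that of `u v⁻¹`.
  If `|z| < |x y - z|` at all pairs of the branch, then the triples are bounded and a limit point of
  them satisfies `x² + y² + z² - x y z = 4`, which contradicts irreducibility
  (`TraceBranch.exists_norm_sub_le`, `trace_fricke_ne_four`). Once `|z| ≥ |x y - z|`, this persists
  and all traces grow without bound (`TraceBranch.exists_large`). A pair with large traces and
  `|z| ≥ |x y - z|` is expanding (`Hyp3.ExpandingPair.of_large_traces`).
-/

/-! ### The distance of hyperbolic space, up to an additive constant -/

namespace Hyp3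

open Matrix
open scoped ComplexOrder

/-- The square of the Hilbert–Schmidt norm of a complex `2 × 2` matrix. -/
noncomputable def hsNormSq (A : Matrix (Fin 2) (Fin 2) ℂ) : ℝ := ∑ i, ∑ j, ‖A i j‖ ^ 2

theorem norm_mul_add_mul_sq_le (a b c d : ℂ) :
    ‖a * c + b * d‖ ^ 2 ≤ (‖a‖ ^ 2 + ‖b‖ ^ 2) * (‖c‖ ^ 2 + ‖d‖ ^ 2) := by
  have h : ‖a * c + b * d‖ ≤ ‖a‖ * ‖c‖ + ‖b‖ * ‖d‖ := by
    simpa using norm_add_le (a * c) (b * d)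
  have h2 : ‖a * c + b * d‖ ^ 2 ≤ (‖a‖ * ‖c‖ + ‖b‖ * ‖d‖) ^ 2 := by gcongr
  nlinarith [sq_nonneg (‖a‖ * ‖d‖ - ‖b‖ * ‖c‖)]

theorem hsNormSq_mul_le (A B : Matrix (Fin 2) (Fin 2) ℂ) :
    hsNormSq (A * B) ≤ hsNormSq A * hsNormSq B := by
  simp only [hsNormSq, Matrix.mul_apply, Fin.sum_univ_two]
  have h1 := norm_mul_add_mul_sq_le (A 0 0) (A 0 1) (B 0 0) (B 1 0)
  have h2 := norm_mul_add_mul_sq_le (A 0 0) (A 0 1) (B 0 1) (B 1 1)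
  have h3 := norm_mul_add_mul_sq_le (A 1 0) (A 1 1) (B 0 0) (B 1 0)
  have h4 := norm_mul_add_mul_sq_le (A 1 0) (A 1 1) (B 0 1) (B 1 1)
  linarith

theorem norm_mulVec_sq_le (A : Matrix (Fin 2) (Fin 2) ℂ) (v : Fin 2 → ℂ) :
    ∑ i, ‖(A *ᵥ v) i‖ ^ 2 ≤ hsNormSq A * ∑ i, ‖v i‖ ^ 2 := by
  simp only [hsNormSq, Matrix.mulVec, dotProduct, Fin.sum_univ_two]
  have h1 := norm_mul_add_mul_sq_le (A 0 0) (A 0 1) (v 0) (v 1)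
  have h2 := norm_mul_add_mul_sq_le (A 1 0) (A 1 1) (v 0) (v 1)
  linarith

/-- The base point, represented by the identity matrix. -/
noncomputable def base : Hyp3 := ⟨1, Matrix.PosDef.one, Matrix.det_one⟩

theorem smul_mat (g : SpecialLinearGroup (Fin 2) ℂ) (P : Hyp3) :
    (g • P).mat = g.1 * P.mat * g.1ᴴ := rfl

/-- `SL(2, ℂ)` acts transitively; this is the Cholesky decomposition. -/
theorem exists_smul_base (P : Hyp3) : ∃ g : SpecialLinearGroup (Fin 2) ℂ, g • base = P := by
  obtain ⟨p, r, q, hP, hp, hpr⟩ := exists_entries P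
  have hs : (√p : ℂ) ≠ 0 := by exact_mod_cast (Real.sqrt_pos.mpr hp).ne'
  have hss : (√p : ℂ) * (√p : ℂ) = (p : ℂ) := by exact_mod_cast Real.mul_self_sqrt hp.le
  have hqq : q * (starRingEnd ℂ) q = (p : ℂ) * r - 1 := by
    rw [Complex.mul_conj]
    have : (Complex.normSq q) = p * r - 1 := by linarith
    rw [this]
    push_cast
    ring
  refine ⟨⟨!![(√p : ℂ), 0; star q / √p, 1 / √p], ?_⟩, ?_⟩
  · rw [Matrix.det_fin_two]
    simp
    field_simp
  · apply Hyp3.ext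
    have hp' : (p : ℂ) ≠ 0 := by exact_mod_cast hp.ne'
    rw [hP]
    change !![(√p : ℂ), 0; star q / √p, 1 / √p] * (1 : Matrix (Fin 2) (Fin 2) ℂ) *
      (!![(√p : ℂ), 0; star q / √p, 1 / √p])ᴴ = _
    ext i j
    fin_cases i <;> fin_cases j
    · simp [Matrix.mul_apply, Fin.sum_univ_two, hss]
    · simp [Matrix.mul_apply, Fin.sum_univ_two]
      field_simp
    · simp [Matrix.mul_apply, Fin.sum_univ_two]
      field_simp
    · simp [Matrix.mul_apply, Fin.sum_univ_two]
      field_simp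
      rw [pow_two, hss, mul_comm, hqq]
      ring

theorem coshDist_smul (g : SpecialLinearGroup (Fin 2) ℂ) (P Q : Hyp3) :
    coshDist (g • P) (g • Q) = coshDist P Q := by
  have hg : IsUnit g.1.det := by rw [g.2]; exact isUnit_one
  have hg' : IsUnit g.1ᴴ.det := by rw [det_conjTranspose, g.2]; simp
  unfold coshDist
  rw [smul_mat, smul_mat, Matrix.mul_inv_rev, Matrix.mul_inv_rev]
  have : g.1ᴴ⁻¹ * (P.mat⁻¹ * g.1⁻¹) * (g.1 * Q.mat * g.1ᴴ) =
      g.1ᴴ⁻¹ * (P.mat⁻¹ * Q.mat * g.1ᴴ) := by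
    simp only [Matrix.mul_assoc, Matrix.nonsing_inv_mul_cancel_left _ _ hg]
  rw [this, Matrix.trace_mul_comm, Matrix.mul_assoc, Matrix.mul_nonsing_inv _ hg', Matrix.mul_one]

theorem coshDist_base_smul (g : SpecialLinearGroup (Fin 2) ℂ) :
    coshDist base (g • base) = hsNormSq g.1 / 2 := by
  unfold coshDist hsNormSq
  rw [smul_mat]
  change ((1 : Matrix (Fin 2) (Fin 2) ℂ)⁻¹ * (g.1 * (1 : Matrix (Fin 2) (Fin 2) ℂ) * g.1ᴴ)).trace.re / 2 = _
  simp only [inv_one, Matrix.one_mul, Matrix.mul_one, Matrix.trace_fin_two, Matrix.mul_apply,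
    Fin.sum_univ_two, Matrix.conjTranspose_apply, ← Complex.normSq_eq_norm_sq, Complex.normSq_apply]
  simp

theorem coshDist_smul_base_smul_base (g h : SpecialLinearGroup (Fin 2) ℂ) :
    coshDist (g • base) (h • base) = hsNormSq (g⁻¹ * h).1 / 2 := by
  rw [← coshDist_base_smul, ← coshDist_smul g base, mul_smul, smul_inv_smul]

theorem hsNormSq_inv (g : SpecialLinearGroup (Fin 2) ℂ) : hsNormSq (g⁻¹).1 = hsNormSq g.1 := by
  have : (g⁻¹).1 = g.1.adjugate := Matrix.SpecialLinearGroup.coe_inv g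
  rw [this, Matrix.adjugate_fin_two]
  simp [hsNormSq, Fin.sum_univ_two]
  ring

theorem coshDist_comm (P Q : Hyp3) : coshDist P Q = coshDist Q P := by
  obtain ⟨g, rfl⟩ := exists_smul_base P
  obtain ⟨h, rfl⟩ := exists_smul_base Q
  rw [coshDist_smul_base_smul_base, coshDist_smul_base_smul_base, ← hsNormSq_inv]
  simp

theorem coshDist_le_mul (P Q R : Hyp3) : coshDist P R ≤ 2 * coshDist P Q * coshDist Q R := by
  obtain ⟨g, rfl⟩ := exists_smul_base P
  obtain ⟨h, rfl⟩ := exists_smul_base Q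
  obtain ⟨k, rfl⟩ := exists_smul_base R
  simp only [coshDist_smul_base_smul_base]
  have h1 := hsNormSq_mul_le (g⁻¹ * h).1 (h⁻¹ * k).1
  have h2 : (g⁻¹ * h).1 * (h⁻¹ * k).1 = (g⁻¹ * k).1 := by
    have e : g⁻¹ * h * (h⁻¹ * k) = g⁻¹ * k := by group
    exact (congrArg Subtype.val e :)
  rw [h2] at h1
  linarith

theorem coshDist_self (P : Hyp3) : coshDist P P = 1 := by
  obtain ⟨g, rfl⟩ := exists_smul_base P
  rw [coshDist_smul_base_smul_base]
  simp [hsNormSq, Matrix.one_apply]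

theorem hdist_nonneg (P Q : Hyp3) : 0 ≤ hdist P Q := Real.arcosh_nonneg (one_le_coshDist P Q)

theorem hdist_comm (P Q : Hyp3) : hdist P Q = hdist Q P := by
  unfold hdist
  rw [coshDist_comm]

theorem hdist_smul (g : SpecialLinearGroup (Fin 2) ℂ) (P Q : Hyp3) :
    hdist (g • P) (g • Q) = hdist P Q := by
  unfold hdist
  rw [coshDist_smul]

theorem hdist_self (P : Hyp3) : hdist P P = 0 := by
  unfold hdist
  rw [coshDist_self, Real.arcosh_zero]

theorem log_coshDist_le_hdist (P Q : Hyp3) : Real.log (coshDist P Q) ≤ hdist P Q := by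
  have h := one_le_coshDist P Q
  rw [Real.log_le_iff_le_exp (by linarith), hdist, Real.exp_arcosh h]
  linarith [Real.sqrt_nonneg (coshDist P Q ^ 2 - 1)]

theorem hdist_le_log_of_coshDist_le {P Q : Hyp3} {c : ℝ} (h : coshDist P Q ≤ c) :
    hdist P Q ≤ Real.log (2 * c) := by
  have h1 := one_le_coshDist P Q
  rw [Real.le_log_iff_exp_le (by linarith), hdist, Real.exp_arcosh h1]
  have : √(coshDist P Q ^ 2 - 1) ≤ coshDist P Q :=
    (Real.sqrt_le_sqrt (by linarith)).trans (Real.sqrt_sq (by linarith)).le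
  linarith

/-- The triangle inequality up to an additive constant, which is all that quasigeodesics need. -/
theorem hdist_le_add_add_log (P Q R : Hyp3) :
    hdist P R ≤ hdist P Q + hdist Q R + Real.log 4 := by
  have h1 := one_le_coshDist P Q
  have h2 := one_le_coshDist Q R
  have h := hdist_le_log_of_coshDist_le (coshDist_le_mul P Q R)
  have e : 2 * (2 * coshDist P Q * coshDist Q R) = coshDist P Q * coshDist Q R * 4 := by ring
  rw [e, Real.log_mul (by positivity) (by norm_num), Real.log_mul (by positivity) (by positivity)]
    at h
  linarith [log_coshDist_le_hdist P Q, log_coshDist_le_hdist Q R]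

theorem translationLength_conj (g X : SpecialLinearGroup (Fin 2) ℂ) :
    translationLength (g * X * g⁻¹) = translationLength X := by
  unfold translationLength
  refine (MulAction.bijective g).surjective.iInf_congr (fun P => g • P) ?_ |>.symm
  intro P
  change hdist (g • P) ((g * X * g⁻¹) • g • P) = _
  rw [← hdist_smul g P, smul_smul, smul_smul]
  simp

theorem weight_le_one {d s : ℝ} (hd : 0 ≤ d) (hs : s ≤ 1) : weight d s ≤ 1 := by
  unfold weight
  split_ifs with h
  · exact hs
  · have hd' : 0 < d := lt_of_le_of_ne hd (Ne.symm h)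
    rw [div_le_one (Real.sinh_pos_iff.mpr hd')]
    exact Real.sinh_le_sinh.mpr (by nlinarith)

theorem coshDist_segment_le (P Q : Hyp3) (s : Set.Icc (0 : ℝ) 1) :
    coshDist P (segment P Q s) ≤ 1 + coshDist P Q := by
  have hd := hdist_nonneg P Q
  have h : coshDist P (segment P Q s) =
      weight (hdist P Q) (1 - s.1) * coshDist P P + weight (hdist P Q) s.1 * coshDist P Q := by
    unfold coshDist
    change (P.mat⁻¹ * ((weight (hdist P Q) (1 - s.1) : ℂ) • P.mat +
      (weight (hdist P Q) s.1 : ℂ) • Q.mat)).trace.re / 2 = _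
    rw [Matrix.mul_add, Matrix.mul_smul, Matrix.mul_smul, Matrix.trace_add, Matrix.trace_smul,
      Matrix.trace_smul]
    simp
    ring
  rw [h, coshDist_self]
  have h1 := weight_le_one hd (show 1 - s.1 ≤ 1 by linarith [s.2.1])
  have h2 := weight_le_one hd s.2.2
  have := one_le_coshDist P Q
  nlinarith

end Hyp3

/-! ### Pairs of matrices that expand a common cone -/

namespace Hyp3

open Matrix

/-- `A` maps the set `C` into itself and expands the linear functional `v ↦ f ⬝ᵥ v` on it by a factor
of at least `κ`. -/
def ExpandsOn (κ : ℝ) (C : Set (Fin 2 → ℂ)) (f : Fin 2 → ℂ) (A : Matrix (Fin 2) (Fin 2) ℂ) : Prop :=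
  ∀ v ∈ C, A *ᵥ v ∈ C ∧ κ * ‖f ⬝ᵥ v‖ ≤ ‖f ⬝ᵥ A *ᵥ v‖

/-- The matrices `A` and `B` map a common set `C` of vectors into itself, and both of them expand one
linear functional, which does not vanish on `C`, by a definite factor on `C`. For matrices in
`SL(2, ℂ)` the set `C` will be the cone over a closed disc of the Riemann sphere that both Möbius
transformations map into itself. -/
def ExpandingPair (A B : Matrix (Fin 2) (Fin 2) ℂ) : Prop :=
  ∃ (κ : ℝ) (C : Set (Fin 2 → ℂ)) (f v₀ : Fin 2 → ℂ), 1 < κ ∧ v₀ ∈ C ∧ f ⬝ᵥ v₀ ≠ 0 ∧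
    ExpandsOn κ C f A ∧ ExpandsOn κ C f B

theorem ExpandsOn.mul {κ : ℝ} {C : Set (Fin 2 → ℂ)} {f : Fin 2 → ℂ}
    {A B : Matrix (Fin 2) (Fin 2) ℂ} (hκ : 1 ≤ κ) (hA : ExpandsOn κ C f A)
    (hB : ExpandsOn κ C f B) : ExpandsOn κ C f (A * B) := by
  intro v hv
  obtain ⟨h1, h2⟩ := hB v hv
  obtain ⟨h3, h4⟩ := hA _ h1
  rw [← Matrix.mulVec_mulVec]
  refine ⟨h3, le_trans ?_ h4⟩
  have : 0 ≤ κ * ‖f ⬝ᵥ v‖ := by positivity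
  nlinarith

namespace ExpandingPair

variable {A B : Matrix (Fin 2) (Fin 2) ℂ}

theorem symm : ExpandingPair A B → ExpandingPair B A := by
  rintro ⟨κ, C, f, v₀, h1, h2, h3, h4, h5⟩
  exact ⟨κ, C, f, v₀, h1, h2, h3, h5, h4⟩

theorem mul_right : ExpandingPair A B → ExpandingPair A (A * B) := by
  rintro ⟨κ, C, f, v₀, h1, h2, h3, h4, h5⟩
  exact ⟨κ, C, f, v₀, h1, h2, h3, h4, h4.mul h1.le h5⟩

theorem mul_left : ExpandingPair A B → ExpandingPair (A * B) B := by
  rintro ⟨κ, C, f, v₀, h1, h2, h3, h4, h5⟩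
  exact ⟨κ, C, f, v₀, h1, h2, h3, h4.mul h1.le h5, h5⟩

theorem conj {P Q : Matrix (Fin 2) (Fin 2) ℂ} (hPQ : Q * P = 1) :
    ExpandingPair A B → ExpandingPair (P * A * Q) (P * B * Q) := by
  rintro ⟨κ, C, f, v₀, h1, h2, h3, h4, h5⟩
  have key : ∀ M, ExpandsOn κ C f M →
      ExpandsOn κ ((fun v => P *ᵥ v) '' C) (f ᵥ* Q) (P * M * Q) := by
    rintro M hM _ ⟨v, hv, rfl⟩
    obtain ⟨h6, h7⟩ := hM v hv
    have e : (P * M * Q) *ᵥ P *ᵥ v = P *ᵥ M *ᵥ v := by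
      rw [Matrix.mulVec_mulVec, Matrix.mul_assoc, hPQ, Matrix.mul_one, Matrix.mulVec_mulVec]
    have e' : ∀ w, f ᵥ* Q ⬝ᵥ P *ᵥ w = f ⬝ᵥ w := fun w => by
      rw [← Matrix.dotProduct_mulVec, Matrix.mulVec_mulVec, hPQ, Matrix.one_mulVec]
    refine ⟨⟨_, h6, e.symm⟩, ?_⟩
    rw [e]
    simpa only [e'] using h7
  refine ⟨κ, (fun v => P *ᵥ v) '' C, f ᵥ* Q, P *ᵥ v₀, h1, ⟨v₀, h2, rfl⟩, ?_, key A h4, key B h5⟩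
  rwa [← Matrix.dotProduct_mulVec, Matrix.mulVec_mulVec, hPQ, Matrix.one_mulVec]

/-- Products of the matrices of an expanding pair grow exponentially with their number of factors. -/
theorem exists_hsNormSq_prod_ge (h : ExpandingPair A B) : ∃ c κ : ℝ, 0 < c ∧ 1 < κ ∧
    ∀ l : List (Matrix (Fin 2) (Fin 2) ℂ), (∀ M ∈ l, M = A ∨ M = B) →
      c * κ ^ l.length ≤ hsNormSq l.prod := by
  obtain ⟨κ, C, f, v₀, h1, h2, h3, h4, h5⟩ := h
  have hgrow : ∀ l : List (Matrix (Fin 2) (Fin 2) ℂ), (∀ M ∈ l, M = A ∨ M = B) →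
      l.prod *ᵥ v₀ ∈ C ∧ κ ^ l.length * ‖f ⬝ᵥ v₀‖ ≤ ‖f ⬝ᵥ l.prod *ᵥ v₀‖ := by
    intro l
    induction l with
    | nil => simpa using h2
    | cons M l ih =>
      intro hl
      obtain ⟨ih1, ih2⟩ := ih fun N hN => hl N (List.mem_cons_of_mem _ hN)
      have hM : ExpandsOn κ C f M := by
        rcases hl M List.mem_cons_self with rfl | rfl <;> assumption
      obtain ⟨h6, h7⟩ := hM _ ih1
      rw [List.prod_cons, ← Matrix.mulVec_mulVec, List.length_cons]
      refine ⟨h6, le_trans ?_ h7⟩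
      rw [pow_succ']
      nlinarith
  have hv : 0 < ‖f ⬝ᵥ v₀‖ ^ 2 := by positivity
  have hcs : ∀ w : Fin 2 → ℂ, ‖f ⬝ᵥ w‖ ^ 2 ≤ (∑ i, ‖f i‖ ^ 2) * ∑ i, ‖w i‖ ^ 2 := fun w => by
    simpa [dotProduct, Fin.sum_univ_two] using norm_mul_add_mul_sq_le (f 0) (f 1) (w 0) (w 1)
  have hB : 0 < (∑ i, ‖f i‖ ^ 2) * ∑ i, ‖v₀ i‖ ^ 2 := hv.trans_le (hcs v₀)
  refine ⟨‖f ⬝ᵥ v₀‖ ^ 2 / ((∑ i, ‖f i‖ ^ 2) * ∑ i, ‖v₀ i‖ ^ 2), κ ^ 2, by positivity,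
    one_lt_pow₀ h1 two_ne_zero, fun l hl => ?_⟩
  have h6 : (κ ^ l.length * ‖f ⬝ᵥ v₀‖) ^ 2 ≤ ‖f ⬝ᵥ l.prod *ᵥ v₀‖ ^ 2 := by
    have : 0 < κ := by linarith
    gcongr
    exact (hgrow l hl).2
  have h7 := norm_mulVec_sq_le l.prod v₀
  have h8 : (∑ i, ‖f i‖ ^ 2) * ∑ i, ‖(l.prod *ᵥ v₀) i‖ ^ 2 ≤
      (∑ i, ‖f i‖ ^ 2) * (hsNormSq l.prod * ∑ i, ‖v₀ i‖ ^ 2) := by gcongr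
  rw [div_mul_eq_mul_div, div_le_iff₀ hB, ← pow_mul, mul_comm 2, pow_mul]
  calc _ = (κ ^ l.length * ‖f ⬝ᵥ v₀‖) ^ 2 := by ring
    _ ≤ _ := h6.trans ((hcs _).trans (h8.trans (le_of_eq (by ring))))

end ExpandingPair

end Hyp3

/-! ### Broken geodesics of an expanding pair -/

section BrokenGeodesic

variable {u v : F2} {w : List (Fin 2 × Bool)}

theorem spell_append (w₁ w₂ : List (Fin 2 × Bool)) :
    spell u v (w₁ ++ w₂) = spell u v w₁ * spell u v w₂ := by
  unfold spell
  rw [← FreeGroup.mul_mk, map_mul]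

theorem spell_singleton {x : Fin 2 × Bool} (hx : x.2 = true) :
    spell u v [x] = u ∨ spell u v [x] = v := by
  obtain ⟨i, b⟩ := x
  obtain rfl : b = true := hx
  fin_cases i
  · exact Or.inl (by simp [spell])
  · exact Or.inr (by simp [spell])

theorem periodicPrefix_add_one (hw : w ∈ positiveWords) (k : ℤ) :
    ∃ e, (e = u ∨ e = v) ∧ periodicPrefix u v w (k + 1) = periodicPrefix u v w k * e := by
  obtain ⟨hne, -, hpos⟩ := hw
  have hn : 0 < (w.length : ℤ) := by exact_mod_cast List.length_pos_iff.mpr hne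
  set n : ℤ := (w.length : ℤ) with hndef
  set q := k / n
  set r := k % n with hr
  have hr0 : 0 ≤ r := Int.emod_nonneg _ hn.ne'
  have hrn : r < n := Int.emod_lt_of_pos _ hn
  have hk : k = r + n * q := (Int.emod_add_mul_ediv k n).symm
  have hlt : r.toNat < w.length := by omega
  refine ⟨spell u v [w[r.toNat]], spell_singleton (hpos _ (List.getElem_mem _)), ?_⟩
  have htake : spell u v (w.take r.toNat) * spell u v [w[r.toNat]] =
      spell u v (w.take (r.toNat + 1)) := by
    rw [← spell_append, List.take_append_getElem hlt]
  unfold periodicPrefix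
  rw [mul_assoc, ← hndef, htake]
  rcases eq_or_lt_of_le (Int.add_one_le_iff.mpr hrn) with h | h
  · have e1 : (k + 1) / n = q + 1 := by
      rw [hk, show r + n * q + 1 = n * (q + 1) by rw [← h]; ring, Int.mul_ediv_cancel_left _ hn.ne']
    have e2 : (k + 1) % n = 0 := by
      rw [hk, show r + n * q + 1 = n * (q + 1) by rw [← h]; ring, Int.mul_emod_right]
    rw [e1, e2, show r.toNat + 1 = w.length by omega, List.take_length, zpow_add_one]
    simp [spell, q]
  · have e1 : (k + 1) / n = q := by
      rw [hk, show r + n * q + 1 = (r + 1) + n * q by ring, Int.add_mul_ediv_left _ _ hn.ne',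
        Int.ediv_eq_zero_of_lt (by omega) h, zero_add]
    have e2 : (k + 1) % n = r + 1 := by
      rw [hk, show r + n * q + 1 = (r + 1) + n * q by ring, Int.add_mul_emod_self_left,
        Int.emod_eq_of_lt (by omega) h]
    rw [e1, e2, show (r + 1).toNat = r.toNat + 1 by omega]

theorem exists_periodicPrefix_add (hw : w ∈ positiveWords) (k : ℤ) (n : ℕ) :
    ∃ l : List F2, l.length = n ∧ (∀ e ∈ l, e = u ∨ e = v) ∧
      periodicPrefix u v w (k + n) = periodicPrefix u v w k * l.prod := by
  induction n with
  | zero => exact ⟨[], by simp⟩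
  | succ n ih =>
    obtain ⟨l, h1, h2, h3⟩ := ih
    obtain ⟨e, he, h4⟩ := periodicPrefix_add_one (u := u) (v := v) hw (k + n)
    refine ⟨l ++ [e], by simp [h1], ?_, ?_⟩
    · intro x hx
      rcases List.mem_append.mp hx with hx | hx
      · exact h2 x hx
      · rw [List.mem_singleton.mp hx]
        exact he
    · rw [List.prod_append, List.prod_singleton, ← mul_assoc, ← h3, ← h4]
      push_cast
      rw [add_assoc]

theorem coshDist_brokenVertex_add_one_le (ρ : F2 →* Matrix.SpecialLinearGroup (Fin 2) ℂ) (O : Hyp3)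
    (hw : w ∈ positiveWords) (k : ℤ) :
    Hyp3.coshDist (brokenVertex ρ O u v w k) (brokenVertex ρ O u v w (k + 1)) ≤
      max (Hyp3.coshDist O (ρ u • O)) (Hyp3.coshDist O (ρ v • O)) := by
  obtain ⟨e, he, h⟩ := periodicPrefix_add_one (u := u) (v := v) hw k
  unfold brokenVertex
  rw [h, map_mul, mul_smul, Hyp3.coshDist_smul]
  rcases he with rfl | rfl
  · exact le_max_left _ _
  · exact le_max_right _ _

/-- A path that stays within distance `D` of a bi-infinite sequence of points whose distances are
coarsely comparable to the distances of the indices is a quasigeodesic, with constants that depend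
on the data of the comparison only. -/
theorem Hyp3.exists_isQuasigeodesic (α β D E : ℝ) (hα : 0 < α) :
    ∃ K ε : ℝ, 0 < K ∧ 0 < ε ∧ ∀ (p : ℤ → Hyp3) (γ : ℝ → Hyp3),
      (∀ t, hdist (p ⌊t⌋) (γ t) ≤ D) → (∀ k, hdist (p k) (p (k + 1)) ≤ E) →
      (∀ k (n : ℕ), α * n - β ≤ hdist (p k) (p (k + n))) → IsQuasigeodesic K ε γ := by
  have hlog : 0 < Real.log 4 := Real.log_pos (by norm_num)
  -- The coarse triangle inequality charges an additional `log 4` for each step.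
  set E' := |E| + Real.log 4 with hE'
  have hE'pos : 0 < E' := by positivity
  have hK : 0 < E' + α⁻¹ := by positivity
  refine ⟨E' + α⁻¹, E' + α + |β| + 2 * |D| + 2 * Real.log 4, hK, by positivity, ?_⟩
  intro p γ hγ hp hlow
  have hup : ∀ k (n : ℕ), hdist (p k) (p (k + n)) ≤ E' * n := by
    intro k n
    induction n with
    | zero => simp [hdist_self]
    | succ n ih =>
      have h1 := hdist_le_add_add_log (p k) (p (k + n)) (p (k + n + 1))
      have h2 := hp (k + n)
      push_cast
      rw [← add_assoc]
      linarith [le_abs_self E]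
  have hKα : (E' + α⁻¹)⁻¹ ≤ α := by
    rw [inv_le_comm₀ hK hα]
    linarith
  -- By symmetry it suffices to compare two parameters in increasing order.
  have main : ∀ s t : ℝ, s ≤ t → (E' + α⁻¹)⁻¹ * |s - t| -
        (E' + α + |β| + 2 * |D| + 2 * Real.log 4) ≤ hdist (γ s) (γ t) ∧
      hdist (γ s) (γ t) ≤ (E' + α⁻¹) * |s - t| +
        (E' + α + |β| + 2 * |D| + 2 * Real.log 4) := by
    intro s t hst
    obtain ⟨n, hn⟩ : ∃ n : ℕ, ⌊t⌋ = ⌊s⌋ + n :=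
      ⟨(⌊t⌋ - ⌊s⌋).toNat, by have := Int.floor_mono hst; omega⟩
    have hn' : (⌊t⌋ : ℝ) = ⌊s⌋ + n := by exact_mod_cast hn
    have h1 := hlow ⌊s⌋ n
    have h2 := hup ⌊s⌋ n
    rw [← hn] at h1 h2
    have h3 := hdist_le_add_add_log (p ⌊s⌋) (γ s) (p ⌊t⌋)
    have h4 := hdist_le_add_add_log (γ s) (γ t) (p ⌊t⌋)
    have h5 := hdist_le_add_add_log (γ s) (p ⌊s⌋) (γ t)
    have h6 := hdist_le_add_add_log (p ⌊s⌋) (p ⌊t⌋) (γ t)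
    have h7 := hγ s
    have h8 := hγ t
    rw [hdist_comm (γ t)] at h4
    rw [hdist_comm (γ s) (p ⌊s⌋)] at h5
    have f1 := Int.floor_le s
    have f2 := Int.lt_floor_add_one s
    have f3 := Int.floor_le t
    have f4 := Int.lt_floor_add_one t
    have hab : |s - t| = t - s := by rw [abs_sub_comm, abs_of_nonneg (by linarith)]
    rw [hab]
    have g1 : (n : ℝ) ≤ t - s + 1 := by linarith
    have g2 : t - s - 1 ≤ n := by linarith
    have g3 : E' * n ≤ E' * (t - s + 1) := by gcongr
    have g4 : α * (t - s - 1) ≤ α * n := by gcongr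
    have g5 : (E' + α⁻¹)⁻¹ * (t - s) ≤ α * (t - s) := by
      have : 0 ≤ t - s := by linarith
      gcongr
    have g6 : 0 ≤ α⁻¹ * (t - s) := mul_nonneg (by positivity) (by linarith)
    have := le_abs_self D
    have := le_abs_self β
    have := abs_nonneg β
    constructor
    · nlinarith
    · nlinarith
  intro s t
  rcases le_total s t with h | h
  · exact main s t h
  · have := main t s h
    rwa [abs_sub_comm, hdist_comm] at this

/-- If `ρ u` and `ρ v` form an expanding pair, then the broken geodesics of the positive words in `u`
and `v` are uniformly quasigeodesic. -/
theorem Hyp3.ExpandingPair.exists_isQuasigeodesic_brokenGeodesic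
    {ρ : F2 →* Matrix.SpecialLinearGroup (Fin 2) ℂ} (h : ExpandingPair (ρ u).1 (ρ v).1)
    (O : Hyp3) : ∃ K ε : ℝ, 0 < K ∧ 0 < ε ∧
      ∀ w ∈ positiveWords, IsQuasigeodesic K ε (brokenGeodesic ρ O u v w) := by
  obtain ⟨c, κ, hc, hκ, hgrow⟩ := h.exists_hsNormSq_prod_ge
  obtain ⟨g, rfl⟩ := exists_smul_base O
  set O := g • base
  set M := max (coshDist O (ρ u • O)) (coshDist O (ρ v • O)) with hM
  have hg : 0 < hsNormSq g.1 := by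
    have := coshDist_base_smul g
    have := one_le_coshDist base (g • base)
    linarith
  set c' := c / (2 * hsNormSq g.1 ^ 2) with hc'
  have hc'pos : 0 < c' := by positivity
  obtain ⟨K, ε, hK, hε, H⟩ := Hyp3.exists_isQuasigeodesic (Real.log κ) (- Real.log c')
    (Real.log (2 * (1 + M))) (Real.log (2 * M)) (Real.log_pos hκ)
  refine ⟨K, ε, hK, hε, fun w hw => H (brokenVertex ρ O u v w) _ ?_ ?_ ?_⟩
  · intro t
    refine hdist_le_log_of_coshDist_le ((coshDist_segment_le _ _ _).trans ?_)
    gcongr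
    exact coshDist_brokenVertex_add_one_le ρ O hw ⌊t⌋
  · exact fun k => hdist_le_log_of_coshDist_le (coshDist_brokenVertex_add_one_le ρ O hw k)
  · intro k n
    obtain ⟨l, hl, hl', hp⟩ := exists_periodicPrefix_add (u := u) (v := v) hw k n
    refine le_trans ?_ (log_coshDist_le_hdist _ _)
    unfold brokenVertex
    rw [hp, map_mul, mul_smul, coshDist_smul]
    have e1 : coshDist O (ρ l.prod • O) = hsNormSq (g⁻¹ * (ρ l.prod * g)).1 / 2 := by
      rw [← coshDist_smul_base_smul_base, mul_smul]
    have e2 : hsNormSq (ρ l.prod).1 ≤ hsNormSq g.1 ^ 2 * hsNormSq (g⁻¹ * (ρ l.prod * g)).1 := by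
      have h1 := hsNormSq_mul_le (g.1 * (g⁻¹ * (ρ l.prod * g)).1) (g⁻¹).1
      have h2 := hsNormSq_mul_le g.1 (g⁻¹ * (ρ l.prod * g)).1
      have h3 : g.1 * (g⁻¹ * (ρ l.prod * g)).1 * (g⁻¹).1 = (ρ l.prod).1 := by
        have e : g * (g⁻¹ * (ρ l.prod * g)) * g⁻¹ = ρ l.prod := by group
        exact (congrArg Subtype.val e :)
      rw [h3, hsNormSq_inv] at h1
      nlinarith
    have e3 : c * κ ^ n ≤ hsNormSq (ρ l.prod).1 := by
      have h1 := hgrow (l.map fun e => (ρ e).1) (by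
        intro N hN
        obtain ⟨e, he, rfl⟩ := List.mem_map.mp hN
        rcases hl' e he with rfl | rfl <;> simp)
      have h2 : (l.map fun e => (ρ e).1).prod = (ρ l.prod).1 := by
        clear hl hl' hp e1 e2 h1
        induction l with
        | nil => simp
        | cons a l ih =>
          rw [List.map_cons, List.prod_cons, ih, List.prod_cons, map_mul]
          rfl
      rwa [List.length_map, hl, h2] at h1
    have hlog : Real.log κ * n - -Real.log c' = Real.log (c' * κ ^ n) := by
      rw [Real.log_mul hc'pos.ne' (by positivity), Real.log_pow]
      ring
    rw [hlog, e1]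
    refine Real.log_le_log (by positivity) ?_
    rw [hc', div_mul_eq_mul_div, div_le_div_iff₀ (by positivity) two_pos]
    nlinarith

end BrokenGeodesic

/-! ### A criterion for expanding pairs -/

namespace Hyp3

open Matrix

/-- If `B` is diagonal and the diagonal of `A` dominates its off-diagonal part, then both matrices
expand the first coordinate on the cone over a disc around the attracting fixed point of `B`. -/
theorem ExpandingPair.of_diagonal {a b c d l : ℂ} (hl : 1 < ‖l‖) (h1 : ‖d‖ < ‖a‖)
    (h2 : 4 * (‖b‖ * ‖c‖) ≤ (‖a‖ - ‖d‖) ^ 2) (h3 : 2 < ‖a‖ + ‖d‖) :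
    ExpandingPair !![a, b; c, d] !![l, 0; 0, l⁻¹] := by
  -- The radius makes the quadratic condition for the disc to be mapped into itself optimal.
  obtain ⟨R, κ, hR, hκ, h4, h5⟩ : ∃ R κ : ℝ, 0 ≤ R ∧ 1 < κ ∧ κ ≤ ‖a‖ - ‖b‖ * R ∧
      ‖c‖ + ‖d‖ * R ≤ R * (‖a‖ - ‖b‖ * R) := by
    rcases eq_or_ne b 0 with rfl | hb
    · refine ⟨‖c‖ / (‖a‖ - ‖d‖), ‖a‖, div_nonneg (norm_nonneg _) (by linarith), by linarith,
        by simp, ?_⟩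
      have : 0 < ‖a‖ - ‖d‖ := by linarith
      simp only [norm_zero, zero_mul, sub_zero]
      apply le_of_eq
      field_simp
      ring
    · have hb' : 0 < ‖b‖ := norm_pos_iff.mpr hb
      have e : ‖b‖ * ((‖a‖ - ‖d‖) / (2 * ‖b‖)) = (‖a‖ - ‖d‖) / 2 := by field_simp
      refine ⟨(‖a‖ - ‖d‖) / (2 * ‖b‖), (‖a‖ + ‖d‖) / 2, div_nonneg (by linarith) (by linarith),
        by linarith, by rw [e]; linarith, ?_⟩
      rw [e]
      set R := (‖a‖ - ‖d‖) / (2 * ‖b‖)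
      have h6 : ‖b‖ * (‖c‖ + ‖d‖ * R) ≤ ‖b‖ * (R * (‖a‖ - (‖a‖ - ‖d‖) / 2)) := by
        have : ‖b‖ * (R * (‖a‖ - (‖a‖ - ‖d‖) / 2)) = (‖b‖ * R) * ((‖a‖ + ‖d‖) / 2) := by ring
        rw [this, mul_add, show ‖b‖ * (‖d‖ * R) = (‖b‖ * R) * ‖d‖ by ring, e]
        nlinarith
      exact le_of_mul_le_mul_left h6 hb'
  have hdot : ∀ v : Fin 2 → ℂ, ![1, 0] ⬝ᵥ v = v 0 := fun v => by simp [dotProduct, Fin.sum_univ_two]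
  refine ⟨min κ ‖l‖, {v | ‖v 1‖ ≤ R * ‖v 0‖}, ![1, 0], ![1, 0], lt_min hκ hl, by simp [hR],
    by simp, ?_, ?_⟩
  · intro v hv
    have hv' : ‖v 1‖ ≤ R * ‖v 0‖ := hv
    have e0 : (!![a, b; c, d] *ᵥ v) 0 = a * v 0 + b * v 1 := by
      simp [Matrix.mulVec, dotProduct, Fin.sum_univ_two]
    have e1 : (!![a, b; c, d] *ᵥ v) 1 = c * v 0 + d * v 1 := by
      simp [Matrix.mulVec, dotProduct, Fin.sum_univ_two]
    have n0 : ‖a‖ * ‖v 0‖ - ‖b‖ * ‖v 1‖ ≤ ‖a * v 0 + b * v 1‖ := by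
      rw [← norm_mul, ← norm_mul]
      have := norm_sub_norm_le (a * v 0) (-(b * v 1))
      rwa [norm_neg, sub_neg_eq_add] at this
    have n1 : ‖c * v 0 + d * v 1‖ ≤ ‖c‖ * ‖v 0‖ + ‖d‖ * ‖v 1‖ := by
      rw [← norm_mul, ← norm_mul]
      exact norm_add_le _ _
    have n2 : ‖b‖ * ‖v 1‖ ≤ ‖b‖ * (R * ‖v 0‖) := by gcongr
    have n3 : ‖d‖ * ‖v 1‖ ≤ ‖d‖ * (R * ‖v 0‖) := by gcongr
    have n4 : κ * ‖v 0‖ ≤ (‖a‖ - ‖b‖ * R) * ‖v 0‖ := by gcongr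
    have n5 : (‖c‖ + ‖d‖ * R) * ‖v 0‖ ≤ R * (‖a‖ - ‖b‖ * R) * ‖v 0‖ := by gcongr
    have n6 : (‖a‖ - ‖b‖ * R) * ‖v 0‖ ≤ ‖a * v 0 + b * v 1‖ := by linarith
    refine ⟨?_, ?_⟩
    · change ‖_‖ ≤ R * ‖_‖
      rw [e0, e1]
      have : R * ((‖a‖ - ‖b‖ * R) * ‖v 0‖) ≤ R * ‖a * v 0 + b * v 1‖ := by gcongr
      linarith
    · rw [hdot, hdot, e0]
      have : min κ ‖l‖ * ‖v 0‖ ≤ κ * ‖v 0‖ := by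
        gcongr
        exact min_le_left _ _
      linarith
  · intro v hv
    have hv' : ‖v 1‖ ≤ R * ‖v 0‖ := hv
    have e0 : (!![l, 0; 0, l⁻¹] *ᵥ v) 0 = l * v 0 := by
      simp [Matrix.mulVec, dotProduct, Fin.sum_univ_two]
    have e1 : (!![l, 0; 0, l⁻¹] *ᵥ v) 1 = l⁻¹ * v 1 := by
      simp [Matrix.mulVec, dotProduct, Fin.sum_univ_two]
    refine ⟨?_, ?_⟩
    · change ‖_‖ ≤ R * ‖_‖
      rw [e0, e1, norm_mul, norm_mul, norm_inv]
      have h6 : ‖l‖⁻¹ * ‖v 1‖ ≤ 1 * ‖v 1‖ := by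
        gcongr
        exact inv_le_one_of_one_le₀ hl.le
      have h7 : R * (1 * ‖v 0‖) ≤ R * (‖l‖ * ‖v 0‖) := by gcongr
      linarith
    · rw [hdot, hdot, e0, norm_mul]
      gcongr
      exact min_le_right _ _

/-! ### Matrices in `SL(2, ℂ)` whose trace lies outside `[-2, 2]` -/

/-- A number outside `[-2, 2]` is the trace `l + l⁻¹` of a hyperbolic or loxodromic element. -/
theorem exists_add_inv_eq {y : ℂ} (hy : ∀ x ∈ Set.Icc (-2 : ℝ) 2, y ≠ (x : ℂ)) :
    ∃ l : ℂ, 1 < ‖l‖ ∧ y = l + l⁻¹ := by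
  obtain ⟨s, hs⟩ := IsAlgClosed.exists_pow_nat_eq (y ^ 2 - 4) (n := 2) two_pos
  set m := (y + s) / 2
  have hm : m * (y - m) = 1 := by
    simp only [m]
    linear_combination (-1 / 4 : ℂ) * hs
  have hm0 : m ≠ 0 := left_ne_zero_of_mul_eq_one hm
  have hinv : y - m = m⁻¹ := eq_inv_of_mul_eq_one_right hm
  have hym : y = m + m⁻¹ := by rw [← hinv]; ring
  rcases lt_trichotomy ‖m‖ 1 with h | h | h
  · refine ⟨m⁻¹, ?_, by rw [inv_inv, add_comm]; exact hym⟩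
    rw [norm_inv]
    exact (one_lt_inv₀ (norm_pos_iff.mpr hm0)).mpr h
  · exfalso
    have hc : m⁻¹ = (starRingEnd ℂ) m := by
      rw [Complex.inv_def, Complex.normSq_eq_norm_sq, h]
      simp
    have hre := Complex.abs_re_le_norm m
    rw [h, abs_le] at hre
    refine hy (2 * m.re) ⟨by linarith, by linarith⟩ ?_
    rw [hym, hc, Complex.add_conj]
  · exact ⟨m, h, hym⟩

/-- Diagonalisation of a matrix of determinant one whose trace is not in `[-2, 2]`. -/
theorem exists_conj_eq_diagonal {B : Matrix (Fin 2) (Fin 2) ℂ} (hdet : B.det = 1)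
    (htr : ∀ x ∈ Set.Icc (-2 : ℝ) 2, B.trace ≠ (x : ℂ)) :
    ∃ (l : ℂ) (P Q : Matrix (Fin 2) (Fin 2) ℂ), 1 < ‖l‖ ∧ Q * P = 1 ∧ P * Q = 1 ∧
      B = P * !![l, 0; 0, l⁻¹] * Q := by
  obtain ⟨l, hl, hB⟩ := exists_add_inv_eq htr
  have hl0 : l ≠ 0 := by rintro rfl; simp at hl; linarith
  have hev : ∀ m : ℂ, (m = l ∨ m = l⁻¹) → ∃ v, v ≠ 0 ∧ B *ᵥ v = m • v := by
    intro m hm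
    have hd : (B - m • (1 : Matrix (Fin 2) (Fin 2) ℂ)).det = 0 := by
      rw [Matrix.det_fin_two] at hdet ⊢
      rw [Matrix.trace_fin_two] at hB
      simp only [Matrix.sub_apply, Matrix.smul_apply, Matrix.one_apply, smul_eq_mul]
      simp only [Fin.isValue, ↓reduceIte, mul_one, zero_ne_one, one_ne_zero, mul_zero, sub_zero]
      have : m ^ 2 - (l + l⁻¹) * m + 1 = 0 := by
        rcases hm with rfl | rfl
        · field_simp; ring
        · field_simp; ring
      linear_combination hdet + this - m * hB
    obtain ⟨v, hv, h⟩ := Matrix.exists_mulVec_eq_zero_iff.mpr hd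
    refine ⟨v, hv, ?_⟩
    rw [Matrix.sub_mulVec, Matrix.smul_mulVec, Matrix.one_mulVec] at h
    exact sub_eq_zero.mp h
  obtain ⟨v, hv, hBv⟩ := hev l (Or.inl rfl)
  obtain ⟨w, hw, hBw⟩ := hev l⁻¹ (Or.inr rfl)
  have hne : l - l⁻¹ ≠ 0 := by
    intro h
    have := congrArg norm (sub_eq_zero.mp h)
    rw [norm_inv] at this
    have h1 := inv_lt_one_of_one_lt₀ hl
    linarith
  set P : Matrix (Fin 2) (Fin 2) ℂ := !![v 0, w 0; v 1, w 1] with hP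
  have v0 := congrFun hBv 0
  have v1 := congrFun hBv 1
  have w0 := congrFun hBw 0
  have w1 := congrFun hBw 1
  simp only [Matrix.mulVec, dotProduct, Fin.sum_univ_two, Pi.smul_apply, smul_eq_mul] at v0 v1 w0 w1
  have hPdet : P.det ≠ 0 := by
    -- Otherwise `w` is a multiple of `v`, and the two eigenvalues agree.
    rw [hP, Matrix.det_fin_two_of]
    intro h
    have h0 : (l - l⁻¹) * (v 0 * w 0) = 0 := by
      linear_combination -w 0 * v0 + v 0 * w0 - B 0 1 * h
    have h1 : (l - l⁻¹) * (v 1 * w 1) = 0 := by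
      linear_combination -w 1 * v1 + v 1 * w1 + B 1 0 * h
    have h2 : (l - l⁻¹) * (v 0 * w 1) = 0 := by
      linear_combination -w 1 * v0 + v 1 * w0 + (B 0 0 - l⁻¹) * h
    have h3 : (l - l⁻¹) * (v 1 * w 0) = 0 := by
      linear_combination h2 - (l - l⁻¹) * h
    simp only [mul_eq_zero, hne, false_or] at h0 h1 h2 h3
    by_cases hv0 : v 0 = 0
    · by_cases hv1 : v 1 = 0
      · exact hv (funext fun i => by fin_cases i <;> assumption)
      · exact hw (funext fun i => by fin_cases i <;> simp_all)
    · exact hw (funext fun i => by fin_cases i <;> simp_all)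
  have hu : IsUnit P.det := isUnit_iff_ne_zero.mpr hPdet
  refine ⟨l, P, P⁻¹, hl, Matrix.nonsing_inv_mul _ hu, Matrix.mul_nonsing_inv _ hu, ?_⟩
  have hBP : B * P = P * !![l, 0; 0, l⁻¹] := by
    ext i j
    fin_cases i <;> fin_cases j <;> simp [hP, Matrix.mul_apply, Fin.sum_univ_two]
    · linear_combination v0
    · linear_combination w0
    · linear_combination v1
    · linear_combination w1
  rw [← hBP, Matrix.mul_assoc, Matrix.mul_nonsing_inv _ hu, Matrix.mul_one]

/-- Simultaneous normal form of a pair: `B` becomes diagonal, and traces and determinants survive. -/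
theorem exists_normal_form {A B : Matrix (Fin 2) (Fin 2) ℂ} (hA : A.det = 1) (hB : B.det = 1)
    (htr : ∀ x ∈ Set.Icc (-2 : ℝ) 2, B.trace ≠ (x : ℂ)) :
    ∃ (a b c d l : ℂ) (P Q : Matrix (Fin 2) (Fin 2) ℂ), 1 < ‖l‖ ∧ Q * P = 1 ∧ P * Q = 1 ∧
      B = P * !![l, 0; 0, l⁻¹] * Q ∧ A = P * !![a, b; c, d] * Q ∧ a * d - b * c = 1 ∧
      B.trace = l + l⁻¹ ∧ A.trace = a + d ∧ (A * B).trace = a * l + d * l⁻¹ := by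
  obtain ⟨l, P, Q, hl, hQP, hPQ, hBe⟩ := exists_conj_eq_diagonal hB htr
  set A' := Q * A * P with hA'
  have hAe : A = P * A' * Q := by
    calc A = (P * Q) * A * (P * Q) := by rw [hPQ, Matrix.one_mul, Matrix.mul_one]
      _ = _ := by simp only [hA', Matrix.mul_assoc]
  have heta : A' = !![A' 0 0, A' 0 1; A' 1 0, A' 1 1] := Matrix.eta_fin_two A'
  have htrace : ∀ M : Matrix (Fin 2) (Fin 2) ℂ, (P * M * Q).trace = M.trace := fun M => by
    rw [Matrix.trace_mul_comm, ← Matrix.mul_assoc, hQP, Matrix.one_mul]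
  refine ⟨A' 0 0, A' 0 1, A' 1 0, A' 1 1, l, P, Q, hl, hQP, hPQ, hBe, heta ▸ hAe, ?_, ?_, ?_, ?_⟩
  · rw [← Matrix.det_fin_two, hA', Matrix.det_mul, Matrix.det_mul, hA, mul_one, ← Matrix.det_mul,
      hQP, Matrix.det_one]
  · rw [hBe, htrace, Matrix.trace_fin_two_of]
  · rw [hAe, htrace, Matrix.trace_fin_two]
  · have : A * B = P * (A' * !![l, 0; 0, l⁻¹]) * Q := by
      rw [hAe, hBe]
      calc _ = P * A' * (Q * P) * !![l, 0; 0, l⁻¹] * Q := by simp only [Matrix.mul_assoc]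
        _ = _ := by rw [hQP, Matrix.mul_one]; simp only [Matrix.mul_assoc]
    rw [this, htrace, Matrix.trace_fin_two]
    simp [Matrix.mul_apply, Fin.sum_univ_two]

end Hyp3

/-! ### Expanding pairs and reducibility in terms of traces -/

namespace Hyp3

open Matrix Filter Topology

/-- If two traces are large and the trace of the product dominates that of the quotient, then the
pair is expanding: `A` and `B` are close to multiples of projections whose images, and whose kernels,
nearly agree. -/
theorem ExpandingPair.of_large_traces {A B : Matrix (Fin 2) (Fin 2) ℂ} (hA : A.det = 1)
    (hB : B.det = 1) {x y z μ : ℂ} (hx : A.trace = x) (hy : B.trace = y) (hz : (A * B).trace = z)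
    (hμ : x ^ 2 + y ^ 2 + z ^ 2 - x * y * z = μ) {M : ℝ} (hM : 100 ≤ M) (hMμ : ‖μ‖ ≤ M)
    (hxM : M ≤ ‖x‖) (hyM : M ≤ ‖y‖) (hzz : ‖x * y - z‖ ≤ ‖z‖) : ExpandingPair A B := by
  have htr : ∀ r ∈ Set.Icc (-2 : ℝ) 2, B.trace ≠ (r : ℂ) := by
    rintro r ⟨hr1, hr2⟩ h
    rw [hy] at h
    rw [h, Complex.norm_real, Real.norm_eq_abs] at hyM
    have := abs_le.mpr ⟨hr1, hr2⟩
    linarith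
  obtain ⟨a, b, c, d, l, P, Q, hl, hQP, -, hBe, hAe, hdet, hyl, hxa, hzl⟩ :=
    exists_normal_form hA hB htr
  rw [hBe, hAe]
  refine ExpandingPair.conj hQP ?_
  rw [hx] at hxa
  rw [hy] at hyl
  rw [hz] at hzl
  have hl0 : l ≠ 0 := by rintro rfl; simp at hl; linarith
  -- `z'` is the trace of the quotient; it is bounded by the two roots `z`, `z'` of a quadratic.
  set z' := x * y - z with hz'
  have hprod : z * z' = x ^ 2 + y ^ 2 - μ := by rw [hz', ← hμ]; ring
  have hX : 0 < ‖x‖ := by linarith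
  have hY : 0 < ‖y‖ := by linarith
  have hzlow : ‖x‖ * ‖y‖ ≤ 2 * ‖z‖ := by
    rw [← norm_mul, show x * y = z + z' by rw [hz']; ring]
    linarith [norm_add_le z z']
  have hprodn : ‖z‖ * ‖z'‖ ≤ ‖x‖ ^ 2 + ‖y‖ ^ 2 + ‖μ‖ := by
    rw [← norm_mul, hprod, ← norm_pow, ← norm_pow]
    exact (norm_sub_le _ _).trans (by linarith [norm_add_le (x ^ 2) (y ^ 2)])
  have hz'up : ‖x‖ * ‖y‖ * ‖z'‖ ≤ 2 * (‖x‖ ^ 2 + ‖y‖ ^ 2 + ‖μ‖) := by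
    have : ‖x‖ * ‖y‖ * ‖z'‖ ≤ 2 * ‖z‖ * ‖z'‖ := by gcongr
    linarith
  have hlinv : ‖l⁻¹‖ ≤ 1 := by
    rw [norm_inv]
    exact inv_le_one_of_one_le₀ hl.le
  have hly : ‖y‖ ≤ ‖l‖ + 1 := by
    rw [hyl]
    exact (norm_add_le _ _).trans (by linarith)
  -- The small diagonal entry of `A` in the eigenbasis of `B`.
  have hdl : (l - l⁻¹) * d = z' - x * l⁻¹ := by
    rw [hz', hzl, hxa, hyl]
    ring
  have hln : ‖l‖ - 1 ≤ ‖l - l⁻¹‖ := by linarith [norm_sub_norm_le l l⁻¹]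
  have hdn : (‖l‖ - 1) * ‖d‖ ≤ ‖z'‖ + ‖x‖ := by
    calc (‖l‖ - 1) * ‖d‖ ≤ ‖l - l⁻¹‖ * ‖d‖ := by gcongr
      _ = ‖z' - x * l⁻¹‖ := by rw [← norm_mul, hdl]
      _ ≤ ‖z'‖ + ‖x‖ * ‖l⁻¹‖ := by rw [← norm_mul]; exact norm_sub_le _ _
      _ ≤ ‖z'‖ + ‖x‖ * 1 := by gcongr
      _ = _ := by ring
  have hz'up' : ‖x‖ * ‖y‖ * ‖z'‖ ≤ ‖x‖ * ‖y‖ * (2 * ‖x‖ / 50 + ‖y‖ / 20 * ‖x‖ / 5) := by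
    refine hz'up.trans ?_
    have e1 : 100 * ‖x‖ ^ 2 ≤ ‖y‖ * ‖x‖ ^ 2 := by
      have : 100 ≤ ‖y‖ := by linarith
      gcongr
    have e2 : 100 ^ 2 * ‖y‖ ^ 2 ≤ ‖x‖ ^ 2 * ‖y‖ ^ 2 := by
      have : 100 ≤ ‖x‖ := by linarith
      gcongr
    have e3 : ‖μ‖ ≤ ‖y‖ * ‖x‖ ^ 2 / 100 := by
      have e4 : 100 * ‖x‖ ≤ ‖x‖ ^ 2 := by nlinarith
      have e5 : 100 * (100 * ‖x‖) ≤ ‖y‖ * ‖x‖ ^ 2 := by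
        have : 100 ≤ ‖y‖ := by linarith
        gcongr
      linarith
    nlinarith
  have hz'fin : ‖z'‖ ≤ 2 * ‖x‖ / 50 + ‖y‖ / 20 * ‖x‖ / 5 :=
    le_of_mul_le_mul_left hz'up' (by positivity)
  -- Any bound `‖d‖ ≤ r ‖x‖` with `4 r (1 + r) < (1 - 2 r) ^ 2` suffices for the criterion.
  have hdfin : ‖d‖ ≤ ‖x‖ / 16 := by
    have h1 : 98 ≤ ‖l‖ - 1 := by linarith
    have h2 : (‖l‖ - 1) * ‖d‖ ≤ (‖l‖ - 1) * (‖x‖ / 16) := by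
      refine hdn.trans ?_
      nlinarith
    exact le_of_mul_le_mul_left h2 (by linarith)
  have haup : ‖a‖ ≤ ‖x‖ + ‖d‖ := by
    rw [show a = x - d by rw [hxa]; ring]
    exact norm_sub_le _ _
  have halow : ‖x‖ ≤ ‖a‖ + ‖d‖ := by
    rw [hxa]
    exact norm_add_le _ _
  have hbc : ‖b‖ * ‖c‖ ≤ ‖a‖ * ‖d‖ + 1 := by
    rw [← norm_mul, ← norm_mul, show b * c = a * d - 1 by linear_combination -hdet]
    exact (norm_sub_le _ _).trans (by simp)
  refine ExpandingPair.of_diagonal hl (by linarith) ?_ (by linarith)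
  have h1 : ‖a‖ * ‖d‖ ≤ (17 / 16 * ‖x‖) * (‖x‖ / 16) := by
    gcongr
    linarith
  have h2 : (7 / 8 * ‖x‖) ^ 2 ≤ (‖a‖ - ‖d‖) ^ 2 := by
    gcongr
    linarith
  nlinarith

/-- If `B` is loxodromic and the traces of `A * B ^ n` do not tend to zero, then `A * B ^ n` and `B`
form an expanding pair for some `n`. -/
theorem ExpandingPair.exists_mul_pow {A B : Matrix (Fin 2) (Fin 2) ℂ} (hA : A.det = 1)
    (hB : B.det = 1) (htr : ∀ x ∈ Set.Icc (-2 : ℝ) 2, B.trace ≠ (x : ℂ))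
    (hfreq : ∃ᶠ n : ℕ in atTop, 2 < ‖(A * B ^ n).trace‖) : ∃ n : ℕ, ExpandingPair (A * B ^ n) B := by
  obtain ⟨a, b, c, d, l, P, Q, hl, hQP, -, hBe, hAe, hdet, -, -, -⟩ := exists_normal_form hA hB htr
  have hl0 : 0 < ‖l‖ := by linarith
  have hpow : ∀ n : ℕ, A * B ^ n = P * !![a * l ^ n, b * (l⁻¹) ^ n; c * l ^ n, d * (l⁻¹) ^ n] * Q := by
    intro n
    induction n with
    | zero => simpa using hAe
    | succ n ih =>
      rw [pow_succ, ← Matrix.mul_assoc, ih]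
      nth_rewrite 1 [hBe]
      calc _ = P * !![a * l ^ n, b * (l⁻¹) ^ n; c * l ^ n, d * (l⁻¹) ^ n] * (Q * P) *
            !![l, 0; 0, l⁻¹] * Q := by simp only [Matrix.mul_assoc]
        _ = _ := by
          rw [hQP, Matrix.mul_one, Matrix.mul_assoc P]
          congr 2
          ext i j
          fin_cases i <;> fin_cases j <;>
            simp [Matrix.mul_apply, Fin.sum_univ_two, pow_succ, mul_assoc]
  have htrace : ∀ n : ℕ, (A * B ^ n).trace = a * l ^ n + d * (l⁻¹) ^ n := fun n => by
    rw [hpow, Matrix.trace_mul_comm, ← Matrix.mul_assoc, hQP, Matrix.one_mul, Matrix.trace_fin_two_of]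
  have hd : Tendsto (fun n : ℕ => ‖d * (l⁻¹) ^ n‖) atTop (𝓝 0) := by
    have h : Tendsto (fun n : ℕ => d * (l⁻¹) ^ n) atTop (𝓝 (d * 0)) := by
      refine (tendsto_pow_atTop_nhds_zero_of_norm_lt_one ?_).const_mul d
      rw [norm_inv]
      exact inv_lt_one_of_one_lt₀ hl
    simpa using h.norm
  -- The attracting point of `B` is not sent to its repelling point: the traces would tend to zero.
  have ha : a ≠ 0 := by
    rintro rfl
    obtain ⟨n, hn1, hn2⟩ := (hfreq.and_eventually (hd.eventually (gt_mem_nhds two_pos))).exists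
    rw [htrace, zero_mul, zero_add] at hn1
    linarith
  have ha' : Tendsto (fun n : ℕ => ‖a * l ^ n‖) atTop atTop := by
    simp only [norm_mul, norm_pow]
    exact (tendsto_pow_atTop_atTop_of_one_lt hl).const_mul_atTop (norm_pos_iff.mpr ha)
  obtain ⟨n, h1, h2⟩ := ((ha'.eventually (eventually_ge_atTop (4 * (‖b‖ * ‖c‖) + 4))).and
    (hd.eventually (gt_mem_nhds one_pos))).exists
  refine ⟨n, ?_⟩
  rw [hpow, hBe]
  refine ExpandingPair.conj hQP (ExpandingPair.of_diagonal hl ?_ ?_ ?_)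
  · have : 0 ≤ ‖b‖ * ‖c‖ := by positivity
    linarith
  · have e : ‖b * (l⁻¹) ^ n‖ * ‖c * l ^ n‖ = ‖b‖ * ‖c‖ := by
      rw [← norm_mul, ← norm_mul]
      congr 1
      have : l ≠ 0 := norm_pos_iff.mp hl0
      rw [inv_pow]
      field_simp
    rw [e]
    have : 0 ≤ ‖b‖ * ‖c‖ := by positivity
    nlinarith
  · have : 0 ≤ ‖b‖ * ‖c‖ := by positivity
    have := norm_nonneg (d * (l⁻¹) ^ n)
    linarith

end Hyp3

/-- The images of a generating pair under an irreducible representation have no common eigenvector,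
so that the Fricke polynomial of their traces avoids the value that belongs to reducible ones. -/
theorem trace_fricke_ne_four {ρ : F2 →* Matrix.SpecialLinearGroup (Fin 2) ℂ}
    (hirr : (linearRep ρ).IsIrreducible) {u v : F2} (huv : IsGeneratorPair u v)
    (htr : ∀ x ∈ Set.Icc (-2 : ℝ) 2, (ρ v).1.trace ≠ (x : ℂ)) :
    (ρ u).1.trace ^ 2 + (ρ v).1.trace ^ 2 + (ρ (u * v)).1.trace ^ 2 -
      (ρ u).1.trace * (ρ v).1.trace * (ρ (u * v)).1.trace ≠ 4 := by
  intro hfour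
  have huvm : (ρ (u * v)).1 = (ρ u).1 * (ρ v).1 := by rw [map_mul]; rfl
  obtain ⟨a, b, c, d, l, P, Q, hl, hQP, hPQ, hBe, hAe, hdet, hy, hx, hz⟩ :=
    Hyp3.exists_normal_form (ρ u).2 (ρ v).2 htr
  rw [huvm, hx, hy, hz] at hfour
  have hl0 : l ≠ 0 := by rintro rfl; simp at hl; linarith
  have hne : l - l⁻¹ ≠ 0 := by
    intro h
    have := congrArg norm (sub_eq_zero.mp h)
    rw [norm_inv] at this
    have h1 := inv_lt_one_of_one_lt₀ hl
    linarith
  have hbc : b = 0 ∨ c = 0 := by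
    have h : (l - l⁻¹) ^ 2 * (b * c) = 0 := by
      have hll : l * l⁻¹ = 1 := mul_inv_cancel₀ hl0
      linear_combination (-(l - l⁻¹) ^ 2) * hdet - hfour +
        (4 - 2 * a * d - a ^ 2 - d ^ 2) * hll
    simpa [hne] using h
  -- A vector of the standard basis is a common eigenvector in the normal form.
  obtain ⟨e, he, ⟨m₁, hm₁⟩, ⟨m₂, hm₂⟩⟩ : ∃ e : Fin 2 → ℂ, e ≠ 0 ∧
      (∃ m : ℂ, !![a, b; c, d].mulVec e = m • e) ∧
      ∃ m : ℂ, !![l, 0; 0, l⁻¹].mulVec e = m • e := by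
    rcases hbc with rfl | rfl
    · refine ⟨![0, 1], fun h => by simpa using congrFun h 1, ⟨d, ?_⟩, ⟨l⁻¹, ?_⟩⟩ <;>
      · ext i
        fin_cases i <;> simp [Matrix.mulVec, dotProduct, Fin.sum_univ_two]
    · refine ⟨![1, 0], fun h => by simpa using congrFun h 0, ⟨a, ?_⟩, ⟨l, ?_⟩⟩ <;>
      · ext i
        fin_cases i <;> simp [Matrix.mulVec, dotProduct, Fin.sum_univ_two]
  set f := P.mulVec e with hf
  have hf0 : f ≠ 0 := by
    intro h
    apply he
    rw [← Matrix.one_mulVec e, ← hQP, ← Matrix.mulVec_mulVec, ← hf, h, Matrix.mulVec_zero]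
  have hconj : ∀ (M : Matrix (Fin 2) (Fin 2) ℂ) (m : ℂ), M.mulVec e = m • e →
      (P * M * Q).mulVec f = m • f := by
    intro M m h
    rw [hf, Matrix.mulVec_mulVec, Matrix.mul_assoc, hQP, Matrix.mul_one, ← Matrix.mulVec_mulVec, h,
      Matrix.mulVec_smul]
  have h1 : (ρ u).1.mulVec f = m₁ • f := by rw [hAe]; exact hconj _ _ hm₁
  have h2 : (ρ v).1.mulVec f = m₂ • f := by rw [hBe]; exact hconj _ _ hm₂
  -- The stabiliser of the line spanned by this eigenvector is a subgroup.
  let S : Subgroup F2 :=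
    { carrier := {g | ∃ m : ℂ, m ≠ 0 ∧ (ρ g).1.mulVec f = m • f}
      one_mem' := ⟨1, one_ne_zero, by simp⟩
      mul_mem' := by
        rintro g h ⟨m, hm, hg⟩ ⟨n, hn, hh⟩
        refine ⟨n * m, mul_ne_zero hn hm, ?_⟩
        have : (ρ (g * h)).1 = (ρ g).1 * (ρ h).1 := by rw [map_mul]; rfl
        rw [this, ← Matrix.mulVec_mulVec, hh, Matrix.mulVec_smul, hg, smul_smul]
      inv_mem' := by
        rintro g ⟨m, hm, hg⟩
        refine ⟨m⁻¹, inv_ne_zero hm, ?_⟩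
        have hi : (ρ g⁻¹).1 * (ρ g).1 = 1 := by
          have : ρ g⁻¹ * ρ g = 1 := by rw [← map_mul, inv_mul_cancel, map_one]
          exact (congrArg Subtype.val this :)
        have h3 : (ρ g⁻¹).1.mulVec (m • f) = f := by
          rw [← hg, Matrix.mulVec_mulVec, hi, Matrix.one_mulVec]
        rw [Matrix.mulVec_smul] at h3
        rw [eq_inv_smul_iff₀ hm]
        exact h3 }
  have hnz : ∀ (g : F2) (m : ℂ), (ρ g).1.mulVec f = m • f → m ≠ 0 := by
    rintro g m h rfl
    rw [zero_smul] at h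
    have hd : (ρ g).1.det ≠ 0 := by rw [(ρ g).2]; exact one_ne_zero
    exact hd (Matrix.exists_mulVec_eq_zero_iff.mp ⟨f, hf0, h⟩)
  have hS : S = ⊤ := by
    rw [eq_top_iff, ← show Subgroup.closure {u, v} = ⊤ from huv, Subgroup.closure_le]
    rintro g (rfl | rfl)
    · exact ⟨m₁, hnz _ _ h1, h1⟩
    · exact ⟨m₂, hnz _ _ h2, h2⟩
  let L : Subrepresentation (linearRep ρ) :=
    { toSubmodule := Submodule.span ℂ {f}
      apply_mem_toSubmodule := by
        intro g w hw
        obtain ⟨r, rfl⟩ := Submodule.mem_span_singleton.mp hw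
        obtain ⟨m, -, hm⟩ : g ∈ S := hS ▸ Subgroup.mem_top g
        have : linearRep ρ g (r • f) = (r * m) • f := by
          change Matrix.toLin' (ρ g).1 (r • f) = _
          rw [Matrix.toLin'_apply, Matrix.mulVec_smul, hm, smul_smul]
        rw [this]
        exact Submodule.smul_mem _ _ (Submodule.mem_span_singleton_self f) }
  rcases hirr.eq_bot_or_eq_top L with h | h
  · have h3 : Submodule.span ℂ {f} = ⊥ := congrArg Subrepresentation.toSubmodule h
    exact hf0 (Submodule.span_singleton_eq_bot.mp h3)
  · have h3 : Submodule.span ℂ {f} = ⊤ := congrArg Subrepresentation.toSubmodule h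
    have h4 := finrank_span_singleton (K := ℂ) hf0
    rw [h3, finrank_top, Module.finrank_fin_fun] at h4
    omega

/-! ### Trace triples along an infinite branch -/

section TraceTriples

open Filter Topology

/-- The trace triple of `(u, u v)` in terms of that of `(u, v)`; a triple lists the traces of the two
generators and of their product. -/
def TraceStepRight (x y z x' y' z' : ℂ) : Prop := x' = x ∧ y' = z ∧ z' = x * z - y

/-- The trace triple of `(u v, v)` in terms of that of `(u, v)`. -/
def TraceStepLeft (x y z x' y' z' : ℂ) : Prop := x' = z ∧ y' = y ∧ z' = z * y - x

/-- The trace triples along an infinite branch of the binary tree of generating pairs which is not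
eventually constant, far enough out that no trace has modulus at most `2`. -/
structure TraceBranch (μ : ℂ) (x y z : ℕ → ℂ) : Prop where
  step : ∀ n, TraceStepRight (x n) (y n) (z n) (x (n + 1)) (y (n + 1)) (z (n + 1)) ∨
    TraceStepLeft (x n) (y n) (z n) (x (n + 1)) (y (n + 1)) (z (n + 1))
  right : ∃ᶠ n in atTop, TraceStepRight (x n) (y n) (z n) (x (n + 1)) (y (n + 1)) (z (n + 1))
  left : ∃ᶠ n in atTop, TraceStepLeft (x n) (y n) (z n) (x (n + 1)) (y (n + 1)) (z (n + 1))
  fricke : ∀ n, x n ^ 2 + y n ^ 2 + z n ^ 2 - x n * y n * z n = μ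
  norm_left : ∀ n, 2 < ‖x n‖
  norm_right : ∀ n, 2 < ‖y n‖
  norm_prod : ∀ n, 2 < ‖z n‖

/-- A lower bound for all new traces is inherited by the traces of the generators once both of them
have been replaced. -/
theorem eventually_le_norm_of_steps {x y z : ℕ → ℂ}
    (step : ∀ n, TraceStepRight (x n) (y n) (z n) (x (n + 1)) (y (n + 1)) (z (n + 1)) ∨
      TraceStepLeft (x n) (y n) (z n) (x (n + 1)) (y (n + 1)) (z (n + 1)))
    (right : ∃ᶠ n in atTop, TraceStepRight (x n) (y n) (z n) (x (n + 1)) (y (n + 1)) (z (n + 1)))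
    (left : ∃ᶠ n in atTop, TraceStepLeft (x n) (y n) (z n) (x (n + 1)) (y (n + 1)) (z (n + 1)))
    {S : Set ℂ} (hz : ∀ᶠ n in atTop, z n ∈ S) : ∀ᶠ n in atTop, x n ∈ S ∧ y n ∈ S := by
  obtain ⟨N, hN⟩ := eventually_atTop.mp hz
  obtain ⟨r, hr, -, hyr, -⟩ := frequently_atTop.mp right N
  obtain ⟨l, hl, hxl, -, -⟩ := frequently_atTop.mp left N
  have hy : ∀ n, r + 1 ≤ n → y n ∈ S := by
    intro n hn
    induction n, hn using Nat.le_induction with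
    | base => rw [hyr]; exact hN r hr
    | succ n hn ih =>
      rcases step n with ⟨-, h, -⟩ | ⟨-, h, -⟩
      · rw [h]; exact hN n (by omega)
      · rw [h]; exact ih
  have hx : ∀ n, l + 1 ≤ n → x n ∈ S := by
    intro n hn
    induction n, hn using Nat.le_induction with
    | base => rw [hxl]; exact hN l hl
    | succ n hn ih =>
      rcases step n with ⟨h, -, -⟩ | ⟨h, -, -⟩
      · rw [h]; exact ih
      · rw [h]; exact hN n (by omega)
  exact eventually_atTop.mpr ⟨max (r + 1) (l + 1), fun n hn =>
    ⟨hx n (le_trans (le_max_right _ _) hn), hy n (le_trans (le_max_left _ _) hn)⟩⟩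

/-- The equality case of `‖a + b‖ ≤ 2 ‖a‖`, for `‖b‖ ≤ ‖a‖`. -/
theorem eq_of_two_mul_norm_le_norm_add {a b : ℂ} (hb : ‖b‖ ≤ ‖a‖) (h : 2 * ‖a‖ ≤ ‖a + b‖) : a = b := by
  have hpar := parallelogram_law_with_norm ℝ a b
  have h1 : ‖a - b‖ * ‖a - b‖ ≤ 0 := by nlinarith [norm_nonneg a, norm_nonneg b]
  have h2 : ‖a - b‖ = 0 := by nlinarith [norm_nonneg (a - b)]
  exact sub_eq_zero.mp (norm_eq_zero.mp h2)

/-- A triple from which two of the three neighbours are not larger, and whose entries have modulus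
at least two, is the triple of a reducible representation. -/
theorem fricke_eq_four_of_sink {x y z : ℂ} (hx : 2 ≤ ‖x‖) (hy : 2 ≤ ‖y‖) (hz : 2 ≤ ‖z‖)
    (h1 : ‖x * y - z‖ ≤ ‖z‖) (h2 : ‖y * z - x‖ ≤ ‖x‖) :
    x ^ 2 + y ^ 2 + z ^ 2 - x * y * z = 4 := by
  have h3 : ‖x‖ * ‖y‖ ≤ 2 * ‖z‖ := by
    rw [← norm_mul]
    have := norm_add_le (x * y - z) z
    rw [sub_add_cancel] at this
    linarith
  have h4 : ‖y‖ * ‖z‖ ≤ 2 * ‖x‖ := by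
    rw [← norm_mul]
    have := norm_add_le (y * z - x) x
    rw [sub_add_cancel] at this
    linarith
  have hxz : ‖x‖ ≤ ‖z‖ := by nlinarith
  have hzx : ‖z‖ ≤ ‖x‖ := by nlinarith
  have e1 : z = x * y - z := by
    refine eq_of_two_mul_norm_le_norm_add h1 ?_
    rw [add_sub_cancel, norm_mul]
    nlinarith
  have e2 : x = y * z - x := by
    refine eq_of_two_mul_norm_le_norm_add h2 ?_
    rw [add_sub_cancel, norm_mul]
    nlinarith
  have hz0 : z ≠ 0 := by rintro rfl; simp at hz; linarith
  have e3 : y ^ 2 = 4 := by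
    have : z * (y ^ 2 - 4) = 0 := by linear_combination -y * e2 - 2 * e1
    rcases mul_eq_zero.mp this with h | h
    · exact absurd h hz0
    · linear_combination h
  linear_combination e3 + (x / 2) * e2 + (z / 2) * e1

namespace TraceBranch

variable {μ : ℂ} {x y z : ℕ → ℂ}

/-- The traces cannot decrease forever along the branch: a limit point would be a sink. -/
theorem exists_norm_sub_le (h : TraceBranch μ x y z) (hμ : μ ≠ 4) :
    ∃ n, ‖x n * y n - z n‖ ≤ ‖z n‖ := by
  by_contra! hdesc
  -- The sum of the moduli decreases, and its decrement is the defect `‖x y - z‖ - ‖z‖` of the next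
  -- triple, which therefore tends to zero.
  set S : ℕ → ℝ := fun n => ‖x n‖ + ‖y n‖ + ‖z n‖ with hS
  have hdiff : ∀ n, S n - S (n + 1) = ‖x (n + 1) * y (n + 1) - z (n + 1)‖ - ‖z (n + 1)‖ := by
    intro n
    simp only [hS]
    rcases h.step n with ⟨e1, e2, e3⟩ | ⟨e1, e2, e3⟩
    · rw [e1, e2, e3, sub_sub_cancel]
      ring
    · rw [e1, e2, e3, sub_sub_cancel]
      ring
  have hanti : Antitone S := antitone_nat_of_succ_le fun n => by
    linarith [hdiff n, hdesc (n + 1)]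
  have hbdd : BddBelow (Set.range S) := ⟨0, by
    rintro _ ⟨n, rfl⟩
    positivity⟩
  have hlim := tendsto_atTop_ciInf hanti hbdd
  have hdefect : Tendsto (fun n => ‖x n * y n - z n‖ - ‖z n‖) atTop (𝓝 0) := by
    rw [← tendsto_add_atTop_iff_nat 1]
    have := hlim.sub (hlim.comp (tendsto_add_atTop_nat 1))
    rw [sub_self] at this
    exact this.congr hdiff
  have hbounded : ∀ n, (x n, y n, z n) ∈ Metric.closedBall (0 : ℂ × ℂ × ℂ) (S 0) := by
    intro n
    have : S n ≤ S 0 := hanti (Nat.zero_le n)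
    have h1 := norm_nonneg (x n)
    have h2 := norm_nonneg (y n)
    have h3 := norm_nonneg (z n)
    rw [mem_closedBall_zero_iff, Prod.norm_def, Prod.norm_def]
    exact max_le (by linarith) (max_le (by linarith) (by linarith))
  -- Just before a step that replaces `x`, the neighbour `y z - x` is known to be smaller than `x`.
  obtain ⟨φ, hφ, hφl⟩ := extraction_of_frequently_atTop h.left
  obtain ⟨⟨X, Y, Z⟩, -, ψ, hψ, hconv⟩ := tendsto_subseq_of_bounded
    Metric.isBounded_closedBall (fun n => hbounded (φ n))
  have hX : Tendsto (fun n => x (φ (ψ n))) atTop (𝓝 X) := (Prod.tendsto_iff _ _).mp hconv |>.1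
  have hYZ := (Prod.tendsto_iff _ _).mp hconv |>.2
  have hY : Tendsto (fun n => y (φ (ψ n))) atTop (𝓝 Y) := (Prod.tendsto_iff _ _).mp hYZ |>.1
  have hZ : Tendsto (fun n => z (φ (ψ n))) atTop (𝓝 Z) := (Prod.tendsto_iff _ _).mp hYZ |>.2
  have htend : Tendsto (fun n => φ (ψ n)) atTop atTop := hφ.tendsto_atTop.comp hψ.tendsto_atTop
  refine hμ (Eq.trans ?_ (fricke_eq_four_of_sink (x := X) (y := Y) (z := Z) ?_ ?_ ?_ ?_ ?_))
  · refine tendsto_nhds_unique tendsto_const_nhds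
      ((((hX.pow 2).add (hY.pow 2)).add (hZ.pow 2)).sub ((hX.mul hY).mul hZ) |>.congr fun n => ?_)
    exact h.fricke _
  · exact ge_of_tendsto' hX.norm fun n => (h.norm_left _).le
  · exact ge_of_tendsto' hY.norm fun n => (h.norm_right _).le
  · exact ge_of_tendsto' hZ.norm fun n => (h.norm_prod _).le
  · have h1 := hdefect.comp htend
    have h2 := (((hX.mul hY).sub hZ).norm).sub hZ.norm
    exact sub_nonpos.mp (tendsto_nhds_unique h2 h1).le
  · refine le_of_tendsto_of_tendsto' ((hY.mul hZ).sub hX).norm hX.norm fun n => ?_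
    obtain ⟨e1, e2, e3⟩ := hφl (ψ n)
    have := hdesc (φ (ψ n) + 1)
    rw [e1, e2, e3, sub_sub_cancel] at this
    rw [mul_comm]
    exact this.le

/-- Once the traces increase they increase forever, and at a definite rate. -/
theorem exists_large (h : TraceBranch μ x y z) (hμ : μ ≠ 4) (M : ℝ) :
    ∃ n, M ≤ ‖x n‖ ∧ M ≤ ‖y n‖ ∧ ‖x n * y n - z n‖ ≤ ‖z n‖ := by
  obtain ⟨n₀, hn₀⟩ := h.exists_norm_sub_le hμ
  set r := min ‖x n₀‖ ‖y n₀‖ / 2 with hr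
  have hr1 : 1 < r := by
    have := lt_min (h.norm_left n₀) (h.norm_right n₀)
    rw [hr]
    linarith
  have hprod : ∀ n, ‖x n * y n - z n‖ ≤ ‖z n‖ → ‖x n‖ * ‖y n‖ ≤ 2 * ‖z n‖ := by
    intro n hn
    rw [← norm_mul]
    have := norm_add_le (x n * y n - z n) (z n)
    rw [sub_add_cancel] at this
    linarith
  have hasc : ∀ n, n₀ ≤ n → 2 * r ≤ ‖x n‖ ∧ 2 * r ≤ ‖y n‖ ∧ ‖x n * y n - z n‖ ≤ ‖z n‖ := by
    intro n hn
    induction n, hn using Nat.le_induction with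
    | base =>
      refine ⟨?_, ?_, hn₀⟩
      · rw [hr]; linarith [min_le_left ‖x n₀‖ ‖y n₀‖]
      · rw [hr]; linarith [min_le_right ‖x n₀‖ ‖y n₀‖]
    | succ n hn ih =>
      obtain ⟨hx, hy, hz⟩ := ih
      have hp := hprod n hz
      have hzr : 2 * r ≤ ‖z n‖ := by nlinarith
      rcases h.step n with ⟨e1, e2, e3⟩ | ⟨e1, e2, e3⟩
      · rw [e1, e2, e3, sub_sub_cancel]
        refine ⟨hx, hzr, ?_⟩
        have h1 := norm_sub_norm_le (x n * z n) (y n)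
        rw [norm_mul] at h1
        have h2 : ‖x n‖ * (‖x n‖ * ‖y n‖) ≤ ‖x n‖ * (2 * ‖z n‖) := by gcongr
        have h4 : 2 * 2 * ‖y n‖ ≤ ‖x n‖ * ‖x n‖ * ‖y n‖ := by
          gcongr <;> linarith
        linarith
      · rw [e1, e2, e3, sub_sub_cancel]
        refine ⟨hzr, hy, ?_⟩
        have h1 := norm_sub_norm_le (z n * y n) (x n)
        rw [norm_mul] at h1
        have h2 : ‖y n‖ * (‖x n‖ * ‖y n‖) ≤ ‖y n‖ * (2 * ‖z n‖) := by gcongr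
        have h4 : 2 * 2 * ‖x n‖ ≤ ‖y n‖ * ‖y n‖ * ‖x n‖ := by
          gcongr <;> linarith
        linarith
  have hgrow : ∀ k : ℕ, ∀ᶠ n in atTop, r ^ k ≤ ‖x n‖ ∧ r ^ k ≤ ‖y n‖ := by
    intro k
    induction k with
    | zero =>
      refine Eventually.of_forall fun n => ?_
      have := h.norm_left n
      have := h.norm_right n
      constructor <;> (rw [pow_zero]; linarith)
    | succ k ih =>
      refine eventually_le_norm_of_steps h.step h.right h.left (S := {w | r ^ (k + 1) ≤ ‖w‖}) ?_
      filter_upwards [ih, eventually_ge_atTop n₀] with n hn hn'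
      obtain ⟨hx, hy, hz⟩ := hasc n hn'
      have hp := hprod n hz
      change r ^ (k + 1) ≤ ‖z n‖
      rw [pow_succ]
      have : r ^ k * (2 * r) ≤ ‖x n‖ * ‖y n‖ := mul_le_mul hn.1 hy (by linarith) (norm_nonneg _)
      linarith
  obtain ⟨k, hk⟩ := pow_unbounded_of_one_lt M hr1
  obtain ⟨n, ⟨hx, hy⟩, hn⟩ := ((hgrow k).and (eventually_ge_atTop n₀)).exists
  exact ⟨n, hk.le.trans hx, hk.le.trans hy, (hasc n hn).2.2⟩

end TraceBranch

end TraceTriples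

/-! ### Positive generating pairs of the free group -/

section PositivePairs

open FreeGroup

/-- The reduced word with letters `l` in which the `i`-th generator always occurs with the
sign `τ i`. -/
def signedWord (τ : Fin 2 → Bool) (l : List (Fin 2)) : List (Fin 2 × Bool) :=
  l.map fun i => (i, τ i)

theorem signedWord_append (τ : Fin 2 → Bool) (l m : List (Fin 2)) :
    signedWord τ (l ++ m) = signedWord τ l ++ signedWord τ m := List.map_append

/-- The element of `F₂` spelled by `signedWord τ l`. -/
def signedElt (τ : Fin 2 → Bool) (l : List (Fin 2)) : F2 := FreeGroup.mk (signedWord τ l)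

theorem signedElt_append (τ : Fin 2 → Bool) (l m : List (Fin 2)) :
    signedElt τ (l ++ m) = signedElt τ l * signedElt τ m := by
  simp [signedElt, signedWord, FreeGroup.mul_mk]

section Reduced

variable {τ : Fin 2 → Bool}

theorem isReduced_of_forall_sign {L : List (Fin 2 × Bool)} (σ : Fin 2 → Bool)
    (h : ∀ x ∈ L, x.2 = σ x.1) : IsReduced L := by
  refine List.Pairwise.isChain ((List.pairwise_iff_forall_sublist).mpr fun {a b} hab e => ?_)
  have ha : a ∈ L := hab.subset (by simp)
  have hb : b ∈ L := hab.subset (by simp)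
  rw [h a ha, h b hb, e]

theorem sign_of_mem_signedWord {l : List (Fin 2)} {x : Fin 2 × Bool} (hx : x ∈ signedWord τ l) :
    x.2 = τ x.1 := by
  obtain ⟨i, -, rfl⟩ := List.mem_map.mp hx
  rfl

theorem sign_of_mem_invRev_signedWord {l : List (Fin 2)} {x : Fin 2 × Bool}
    (hx : x ∈ invRev (signedWord τ l)) : x.2 = !τ x.1 := by
  simp only [invRev, List.mem_reverse, List.mem_map, signedWord] at hx
  obtain ⟨y, ⟨i, -, rfl⟩, rfl⟩ := hx
  rfl

theorem head?_signedWord (l : List (Fin 2)) :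
    (signedWord τ l).head? = l.head?.map fun i => (i, τ i) := by
  simp [signedWord]

theorem getLast?_signedWord (l : List (Fin 2)) :
    (signedWord τ l).getLast? = l.getLast?.map fun i => (i, τ i) := by
  simp [signedWord]

theorem head?_invRev_signedWord (l : List (Fin 2)) :
    (invRev (signedWord τ l)).head? = l.getLast?.map fun i => (i, !τ i) := by
  simp [signedWord, invRev, Function.comp_def]

theorem getLast?_invRev_signedWord (l : List (Fin 2)) :
    (invRev (signedWord τ l)).getLast? = l.head?.map fun i => (i, !τ i) := by
  simp [signedWord, invRev, Function.comp_def]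

theorem eq_of_mk_eq_mk {L L' : List (Fin 2 × Bool)} (hL : IsReduced L) (hL' : IsReduced L')
    (h : FreeGroup.mk L = FreeGroup.mk L') : L = L' := by
  rw [← hL.reduce_eq, ← hL'.reduce_eq, FreeGroup.reduce.sound h]

/-- The part of the reduced word of a product that is contributed by its first letter: the word `l`
or its inverse. -/
def letterBlock (τ : Fin 2 → Bool) (l : List (Fin 2)) (b : Bool) : List (Fin 2 × Bool) :=
  if b then signedWord τ l else invRev (signedWord τ l)

/-- The cancellation-free part of the reduced word that precedes the block of the first letter: it is
empty if that letter has exponent one, and the inverse of the common suffix `s` otherwise. -/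
def inversePrefix (τ : Fin 2 → Bool) (s : List (Fin 2)) (b : Bool) : List (Fin 2 × Bool) :=
  if b then [] else invRev (signedWord τ s)

/-- If two words `P 0 ++ s` and `P 1 ++ s` have different first letters and `s` is their longest
common suffix, then in a product of the two elements and their inverses nothing cancels but `s`
against `s⁻¹`, so that every factor contributes at least one letter to the reduced word. -/
theorem exists_isReduced_lift_mk {P : Fin 2 → List (Fin 2)} (s : List (Fin 2))
    (hne : ∀ i, P i ≠ []) (hhead : ∀ i j, i ≠ j → (P i).head? ≠ (P j).head?)
    (hlast : ∀ i j, i ≠ j → (P i).getLast? ≠ (P j).getLast?)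
    (i : Fin 2) (b : Bool) (W : List (Fin 2 × Bool)) (hW : IsReduced ((i, b) :: W)) :
    ∃ L, IsReduced (inversePrefix τ s b ++ (letterBlock τ (P i) b ++ L)) ∧
      FreeGroup.lift (fun i => signedElt τ (P i ++ s)) (FreeGroup.mk ((i, b) :: W)) =
        FreeGroup.mk (inversePrefix τ s b ++ (letterBlock τ (P i) b ++ L)) ∧ W.length ≤ L.length := by
  induction W generalizing i b with
  | nil =>
    refine ⟨if b then signedWord τ s else [], ?_, ?_, by simp⟩
    · cases b
      · refine isReduced_of_forall_sign (fun i => !τ i) fun x hx => ?_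
        simp only [inversePrefix, letterBlock, Bool.false_eq_true, if_false, List.append_nil,
          List.mem_append] at hx
        rcases hx with hx | hx <;> exact sign_of_mem_invRev_signedWord hx
      · refine isReduced_of_forall_sign τ fun x hx => ?_
        simp only [inversePrefix, letterBlock, if_true, List.nil_append, List.mem_append] at hx
        rcases hx with hx | hx <;> exact sign_of_mem_signedWord hx
    · cases b
      · simp [inversePrefix, letterBlock, signedWord_append, signedElt, FreeGroup.inv_mk]
      · simp [inversePrefix, letterBlock, signedWord_append, signedElt]
  | cons y W ih =>
    obtain ⟨j, c⟩ := y
    rw [isReduced_cons_cons] at hW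
    obtain ⟨hij, hW'⟩ := hW
    obtain ⟨L, hL, hmk, hlen⟩ := ih j c hW'
    have hmul : FreeGroup.lift (fun i => signedElt τ (P i ++ s)) (FreeGroup.mk ((i, b) :: (j, c) :: W)) =
        (FreeGroup.lift (fun i => signedElt τ (P i ++ s)) (FreeGroup.mk [(i, b)])) *
          FreeGroup.mk (inversePrefix τ s c ++ (letterBlock τ (P j) c ++ L)) := by
      rw [← hmk, ← _root_.map_mul, FreeGroup.mul_mk, List.singleton_append]
    have hblock : 1 ≤ (letterBlock τ (P j) c).length := by
      rw [Nat.one_le_iff_ne_zero, Ne, List.length_eq_zero_iff]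
      have := hne j
      cases c <;> simpa [letterBlock, signedWord, invRev] using this
    have hrest : IsReduced (letterBlock τ (P j) c ++ L) := hL.infix ⟨inversePrefix τ s c, [], by simp⟩
    have hblockhead : (letterBlock τ (P j) c ++ L).head? = (letterBlock τ (P j) c).head? :=
      List.head?_append_of_ne_nil _ (List.length_pos_iff.mp hblock)
    rw [hmul]
    cases b <;> cases c
    · -- `s⁻¹ pᵢ⁻¹ s⁻¹ pⱼ⁻¹ ⋯` is a concatenation of inverse letters up to the tail.
      refine ⟨invRev (signedWord τ s) ++ (letterBlock τ (P j) false ++ L), ?_, ?_, ?_⟩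
      · have e : inversePrefix τ s false ++ (letterBlock τ (P i) false ++
            (invRev (signedWord τ s) ++ (letterBlock τ (P j) false ++ L))) =
            (invRev (signedWord τ s) ++ invRev (signedWord τ (P i)) ++ invRev (signedWord τ s)) ++
              (letterBlock τ (P j) false ++ L) := by
          simp [inversePrefix, letterBlock]
        rw [e]
        have hneg : ∀ x ∈ invRev (signedWord τ s) ++ invRev (signedWord τ (P i)) ++
            invRev (signedWord τ s), x.2 = !τ x.1 := by
          intro x hx
          simp only [List.mem_append] at hx
          rcases hx with (hx | hx) | hx <;> exact sign_of_mem_invRev_signedWord hx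
        refine List.IsChain.append (isReduced_of_forall_sign (fun i => !τ i) hneg) hrest fun x hx y hy h => ?_
        rw [hblockhead] at hy
        have hy' : y ∈ invRev (signedWord τ (P j)) := by
          simpa [letterBlock] using List.mem_of_mem_head? hy
        rw [hneg x (List.mem_of_mem_getLast? hx), sign_of_mem_invRev_signedWord hy', h]
      · simp [inversePrefix, letterBlock, signedWord_append, signedElt, FreeGroup.inv_mk,
          FreeGroup.mul_mk]
      · simp only [List.length_append, List.length_cons]
        omega
    · -- `s⁻¹ pᵢ⁻¹ pⱼ ⋯` is reduced as the first letters of `pᵢ` and `pⱼ` differ.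
      have hne' : i ≠ j := fun h => by simpa using hij h
      refine ⟨letterBlock τ (P j) true ++ L, ?_, ?_, ?_⟩
      · have e : inversePrefix τ s false ++ (letterBlock τ (P i) false ++
            (letterBlock τ (P j) true ++ L)) =
            (invRev (signedWord τ s) ++ invRev (signedWord τ (P i))) ++
              (letterBlock τ (P j) true ++ L) := by
          simp [inversePrefix, letterBlock]
        rw [e]
        refine List.IsChain.append (isReduced_of_forall_sign (fun i => !τ i) ?_) hrest
          fun x hx y hy h => ?_
        · intro x hx
          simp only [List.mem_append] at hx
          rcases hx with hx | hx <;> exact sign_of_mem_invRev_signedWord hx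
        · rw [hblockhead] at hy
          have hnil : invRev (signedWord τ (P i)) ≠ [] := by
            have := hne i
            simpa [invRev, signedWord] using this
          rw [List.getLast?_append_of_ne_nil _ hnil, getLast?_invRev_signedWord] at hx
          simp only [letterBlock, if_true, head?_signedWord] at hy
          simp only [Option.mem_def, Option.map_eq_some_iff] at hx hy
          obtain ⟨x', hx', rfl⟩ := hx
          obtain ⟨y', hy', rfl⟩ := hy
          obtain rfl : x' = y' := h
          exact absurd (hx'.trans hy'.symm) (hhead i j hne')
      · simp [inversePrefix, letterBlock, signedWord_append, signedElt, FreeGroup.inv_mk,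
          FreeGroup.mul_mk]
      · simp only [List.length_append, List.length_cons]
        omega
    · -- `pᵢ s s⁻¹ pⱼ⁻¹ ⋯` reduces to `pᵢ pⱼ⁻¹ ⋯` as the last letters of `pᵢ` and `pⱼ` differ.
      have hne' : i ≠ j := fun h => by simpa using hij h
      refine ⟨letterBlock τ (P j) false ++ L, ?_, ?_, ?_⟩
      · have e : inversePrefix τ s true ++ (letterBlock τ (P i) true ++
            (letterBlock τ (P j) false ++ L)) =
            signedWord τ (P i) ++ (letterBlock τ (P j) false ++ L) := by
          simp [inversePrefix, letterBlock]
        rw [e]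
        refine List.IsChain.append (isReduced_of_forall_sign τ fun x => sign_of_mem_signedWord)
          hrest fun x hx y hy h => ?_
        rw [hblockhead] at hy
        rw [getLast?_signedWord] at hx
        simp only [letterBlock, Bool.false_eq_true, if_false, head?_invRev_signedWord] at hy
        simp only [Option.mem_def, Option.map_eq_some_iff] at hx hy
        obtain ⟨x', hx', rfl⟩ := hx
        obtain ⟨y', hy', rfl⟩ := hy
        obtain rfl : x' = y' := h
        exact absurd (hx'.trans hy'.symm) (hlast i j hne')
      · have e1 : FreeGroup.lift (fun i => signedElt τ (P i ++ s)) (FreeGroup.mk [(i, true)]) =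
            FreeGroup.mk (signedWord τ (P i)) * FreeGroup.mk (signedWord τ s) := by
          simp [signedWord_append, signedElt, FreeGroup.mul_mk]
        have e2 : FreeGroup.mk (inversePrefix τ s false ++ (letterBlock τ (P j) false ++ L)) =
            (FreeGroup.mk (signedWord τ s))⁻¹ * FreeGroup.mk (letterBlock τ (P j) false ++ L) := by
          simp [inversePrefix, FreeGroup.inv_mk, FreeGroup.mul_mk]
        rw [e1, e2, mul_assoc, mul_inv_cancel_left, FreeGroup.mul_mk]
        simp [inversePrefix, letterBlock]
      · simp only [List.length_append, List.length_cons]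
        omega
    · -- `pᵢ s pⱼ ⋯` is a concatenation of positive letters up to the tail.
      refine ⟨signedWord τ s ++ (letterBlock τ (P j) true ++ L), ?_, ?_, ?_⟩
      · have e : inversePrefix τ s true ++ (letterBlock τ (P i) true ++
            (signedWord τ s ++ (letterBlock τ (P j) true ++ L))) =
            (signedWord τ (P i) ++ signedWord τ s) ++ (letterBlock τ (P j) true ++ L) := by
          simp [inversePrefix, letterBlock]
        rw [e]
        have hpos : ∀ x ∈ signedWord τ (P i) ++ signedWord τ s, x.2 = τ x.1 := by
          intro x hx
          simp only [List.mem_append] at hx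
          rcases hx with hx | hx <;> exact sign_of_mem_signedWord hx
        refine List.IsChain.append (isReduced_of_forall_sign _ hpos) hrest fun x hx y hy h => ?_
        rw [hblockhead] at hy
        have hy' : y ∈ signedWord τ (P j) := by
          simpa [letterBlock] using List.mem_of_mem_head? hy
        rw [hpos x (List.mem_of_mem_getLast? hx), sign_of_mem_signedWord hy', h]
      · simp [inversePrefix, letterBlock, signedWord_append, signedElt, FreeGroup.mul_mk]
      · simp only [List.length_append, List.length_cons]
        omega

end Reduced

/-- The ordered pairs obtained from `(a, b)` by the moves `(u, v) ↦ (u, u v)` and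
`(u, v) ↦ (u v, v)`. -/
inductive IsDescendant (a b : F2) : F2 → F2 → Prop
  | refl : IsDescendant a b a b
  | right {u v : F2} : IsDescendant a b u v → IsDescendant a b u (u * v)
  | left {u v : F2} : IsDescendant a b u v → IsDescendant a b (u * v) v

theorem IsDescendant.eq_or_child {a b u v : F2} (h : IsDescendant a b u v) :
    (u = a ∧ v = b) ∨ IsDescendant a (a * b) u v ∨ IsDescendant (a * b) b u v := by
  induction h with
  | refl => exact Or.inl ⟨rfl, rfl⟩
  | right _ ih =>
    rcases ih with ⟨rfl, rfl⟩ | h | h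
    · exact Or.inr (Or.inl .refl)
    · exact Or.inr (Or.inl h.right)
    · exact Or.inr (Or.inr h.right)
  | left _ ih =>
    rcases ih with ⟨rfl, rfl⟩ | h | h
    · exact Or.inr (Or.inr .refl)
    · exact Or.inr (Or.inl h.left)
    · exact Or.inr (Or.inr h.left)

/-- Up to simultaneous conjugation and exchange, `(x, y)` is a descendant of `(a, b)`. -/
def IsConjDescendant (a b x y : F2) : Prop :=
  ∃ u v g : F2, IsDescendant a b u v ∧
    ((x = g * u * g⁻¹ ∧ y = g * v * g⁻¹) ∨ (x = g * v * g⁻¹ ∧ y = g * u * g⁻¹))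

namespace IsConjDescendant

variable {a b x y : F2}

theorem symm : IsConjDescendant a b x y → IsConjDescendant a b y x := by
  rintro ⟨u, v, g, h, h' | h'⟩
  · exact ⟨u, v, g, h, Or.inr h'.symm⟩
  · exact ⟨u, v, g, h, Or.inl h'.symm⟩

theorem conj (k : F2) :
    IsConjDescendant a b x y → IsConjDescendant a b (k * x * k⁻¹) (k * y * k⁻¹) := by
  rintro ⟨u, v, g, h, ⟨rfl, rfl⟩ | ⟨rfl, rfl⟩⟩
  · exact ⟨u, v, k * g, h, Or.inl ⟨by group, by group⟩⟩
  · exact ⟨u, v, k * g, h, Or.inr ⟨by group, by group⟩⟩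

theorem mul_right : IsConjDescendant a b x y → IsConjDescendant a b x (x * y) := by
  rintro ⟨u, v, g, h, ⟨rfl, rfl⟩ | ⟨rfl, rfl⟩⟩
  · exact ⟨u, u * v, g, h.right, Or.inl ⟨by group, by group⟩⟩
  · exact ⟨u * v, v, g * v, h.left, Or.inr ⟨by group, by group⟩⟩

theorem mul_left (h : IsConjDescendant a b x y) : IsConjDescendant a b x (y * x) := by
  have := h.mul_right.conj x⁻¹
  have e1 : x⁻¹ * x * x⁻¹⁻¹ = x := by group
  have e2 : x⁻¹ * (x * y) * x⁻¹⁻¹ = y * x := by group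
  rwa [e1, e2] at this

end IsConjDescendant

namespace IsGeneratorPair

variable {x y : F2}

theorem symm (h : IsGeneratorPair x y) : IsGeneratorPair y x := by
  unfold IsGeneratorPair at *
  rwa [Set.pair_comm]

theorem of_mem {x' y' : F2} (h : IsGeneratorPair x y) (hx : x ∈ Subgroup.closure {x', y'})
    (hy : y ∈ Subgroup.closure {x', y'}) : IsGeneratorPair x' y' := by
  unfold IsGeneratorPair at *
  rw [eq_top_iff, ← h, Subgroup.closure_le]
  rintro z (rfl | rfl) <;> assumption

theorem mul_right (h : IsGeneratorPair x y) : IsGeneratorPair x (x * y) := by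
  have h1 : x ∈ Subgroup.closure {x, x * y} := Subgroup.subset_closure (by simp)
  have h2 : x * y ∈ Subgroup.closure {x, x * y} := Subgroup.subset_closure (by simp)
  refine h.of_mem h1 ?_
  simpa using Subgroup.mul_mem _ (Subgroup.inv_mem _ h1) h2

theorem mul_left (h : IsGeneratorPair x y) : IsGeneratorPair (x * y) y := by
  have h1 : y ∈ Subgroup.closure {x * y, y} := Subgroup.subset_closure (by simp)
  have h2 : x * y ∈ Subgroup.closure {x * y, y} := Subgroup.subset_closure (by simp)
  refine h.of_mem ?_ h1
  simpa using Subgroup.mul_mem _ h2 (Subgroup.inv_mem _ h1)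

theorem conj (g : F2) (h : IsGeneratorPair x y) :
    IsGeneratorPair (g * x * g⁻¹) (g * y * g⁻¹) := by
  unfold IsGeneratorPair at *
  have e : ({g * x * g⁻¹, g * y * g⁻¹} : Set F2) = (MulAut.conj g).toMonoidHom '' {x, y} := by
    simp [Set.image_pair]
  rw [e, ← MonoidHom.map_closure, h]
  exact Subgroup.map_top_of_surjective _ (MulAut.conj g).surjective

theorem ne_one (h : IsGeneratorPair x y) : x ≠ 1 := by
  rintro rfl
  have htop : Subgroup.zpowers y = ⊤ := by
    rw [eq_top_iff, ← show Subgroup.closure {1, y} = ⊤ from h, Subgroup.closure_le]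
    rintro z (rfl | rfl)
    · exact Subgroup.one_mem _
    · exact Subgroup.mem_zpowers _
  have hmem : ∀ z : F2, ∃ n : ℤ, y ^ n = z := fun z =>
    Subgroup.mem_zpowers_iff.mp (htop ▸ Subgroup.mem_top z)
  obtain ⟨m, hm⟩ := hmem (FreeGroup.of 0)
  obtain ⟨n, hn⟩ := hmem (FreeGroup.of 1)
  have hcomm : (FreeGroup.of 0 * FreeGroup.of 1 : F2) = FreeGroup.of 1 * FreeGroup.of 0 := by
    rw [← hm, ← hn, ← zpow_add, ← zpow_add, add_comm]
  have := congrArg FreeGroup.toWord hcomm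
  revert this
  decide

end IsGeneratorPair

theorem ne_nil_of_signedElt_ne_one {τ : Fin 2 → Bool} {l : List (Fin 2)} : signedElt τ l ≠ 1 → l ≠ [] := by
  rintro h rfl
  exact h rfl

/-- Two words with different first letters and no suffix relation generate only if they are the two
letters. -/
theorem eq_letters_of_isGeneratorPair {τ : Fin 2 → Bool} {P : Fin 2 → List (Fin 2)}
    {s : List (Fin 2)} (hgen : IsGeneratorPair (signedElt τ (P 0 ++ s)) (signedElt τ (P 1 ++ s)))
    (hne : ∀ i, P i ≠ []) (hhead : (P 0).head? ≠ (P 1).head?)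
    (hlast : (P 0).getLast? ≠ (P 1).getLast?) : s = [] ∧ ∀ k, ∃ i, P i = [k] := by
  have hhead' : ∀ i j, i ≠ j → (P i).head? ≠ (P j).head? := by
    intro i j hij
    fin_cases i <;> fin_cases j
    · exact absurd rfl hij
    · exact hhead
    · exact hhead.symm
    · exact absurd rfl hij
  have hlast' : ∀ i j, i ≠ j → (P i).getLast? ≠ (P j).getLast? := by
    intro i j hij
    fin_cases i <;> fin_cases j
    · exact absurd rfl hij
    · exact hlast
    · exact hlast.symm
    · exact absurd rfl hij
  have hsurj : (FreeGroup.lift fun i => signedElt τ (P i ++ s)).range = ⊤ := by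
    rw [FreeGroup.range_lift_eq_closure, ← show Subgroup.closure _ = ⊤ from hgen]
    congr 1
    ext z
    simp [Fin.exists_fin_two, eq_comm]
  have key : ∀ k, s = [] ∧ ∃ i, P i = [k] := by
    intro k
    obtain ⟨g, hg⟩ : FreeGroup.mk [(k, true)] ∈
        (FreeGroup.lift fun i => signedElt τ (P i ++ s)).range := hsurj ▸ Subgroup.mem_top _
    have hgw : FreeGroup.mk g.toWord = g := FreeGroup.mk_toWord
    have hred : IsReduced g.toWord := isReduced_toWord
    rcases hw : g.toWord with _ | ⟨⟨i, b⟩, W⟩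
    · exfalso
      rw [FreeGroup.toWord_eq_nil_iff.mp hw, _root_.map_one] at hg
      exact (FreeGroup.of_ne_one k) hg.symm
    rw [hw] at hgw hred
    obtain ⟨L, hL, hmk, hlen⟩ :=
      exists_isReduced_lift_mk (τ := τ) s hne hhead' hlast' i b W hred
    rw [hgw, hg] at hmk
    have hword := eq_of_mk_eq_mk .singleton hL hmk
    have hl := congrArg List.length hword
    have hblock : 1 ≤ (letterBlock τ (P i) b).length := by
      rw [Nat.one_le_iff_ne_zero, Ne, List.length_eq_zero_iff]
      have := hne i
      cases b <;> simpa [letterBlock, signedWord, invRev] using this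
    simp only [List.length_append, List.length_singleton] at hl
    have hL0 : L = [] := List.length_eq_zero_iff.mp (by omega)
    have hW0 : W = [] := List.length_eq_zero_iff.mp (by omega)
    have hpre : inversePrefix τ s b = [] := List.length_eq_zero_iff.mp (by omega)
    have hP1 : (P i).length = 1 := by
      have : (letterBlock τ (P i) b).length = (P i).length := by
        cases b <;> simp [letterBlock, signedWord, invRev]
      omega
    obtain ⟨m, hm⟩ := List.length_eq_one_iff.mp hP1
    rw [hL0, hpre, hm] at hword
    have hkm : k = m := by
      cases b <;> simp [letterBlock, signedWord, invRev] at hword <;> exact hword.1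
    refine ⟨?_, i, by rw [hm, hkm]⟩
    cases b
    · simpa [inversePrefix, signedWord, invRev] using hpre
    · -- The generator itself is `P i ++ s`, a word without cancellation.
      have h1 : FreeGroup.mk [(k, true)] = FreeGroup.mk (signedWord τ (P i ++ s)) := by
        rw [← hg, ← hgw, hW0]
        simp [signedElt]
      have h2 := congrArg List.length (eq_of_mk_eq_mk .singleton
        (isReduced_of_forall_sign τ fun x => sign_of_mem_signedWord) h1)
      simp only [signedWord, List.length_map, List.length_append, List.length_singleton] at h2
      exact List.length_eq_zero_iff.mp (by omega)
  exact ⟨(key 0).1, fun k => (key k).2⟩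

/-- Two lists split off their longest common prefix. -/
theorem List.exists_common_prefix {α : Type*} (l m : List α) : ∃ f l' m', l = f ++ l' ∧
    m = f ++ m' ∧ (l' = [] ∨ m' = [] ∨ (l' ≠ [] ∧ m' ≠ [] ∧ l'.head? ≠ m'.head?)) := by
  classical
  induction l generalizing m with
  | nil => exact ⟨[], [], m, rfl, rfl, Or.inl rfl⟩
  | cons a l ih =>
    rcases m with _ | ⟨b, m⟩
    · exact ⟨[], a :: l, [], rfl, rfl, Or.inr (Or.inl rfl)⟩
    · by_cases h : a = b
      · obtain ⟨f, l', m', rfl, rfl, h'⟩ := ih m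
        exact ⟨a :: f, l', m', rfl, by rw [h]; rfl, h'⟩
      · exact ⟨[], a :: l, b :: m, rfl, rfl, Or.inr (Or.inr ⟨by simp, by simp, by simpa using h⟩)⟩

/-- Two lists split off their longest common suffix. -/
theorem List.exists_common_suffix {α : Type*} (l m : List α) : ∃ s l' m', l = l' ++ s ∧
    m = m' ++ s ∧ (l' = [] ∨ m' = [] ∨ (l' ≠ [] ∧ m' ≠ [] ∧ l'.getLast? ≠ m'.getLast?)) := by
  obtain ⟨f, l', m', h1, h2, h3⟩ := List.exists_common_prefix l.reverse m.reverse
  refine ⟨f.reverse, l'.reverse, m'.reverse, ?_, ?_, ?_⟩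
  · rw [← List.reverse_append, ← h1, List.reverse_reverse]
  · rw [← List.reverse_append, ← h2, List.reverse_reverse]
  · simpa using h3

/-- A generating pair of words without inverse letters is, up to conjugation and exchange, obtained
from the two letters by the moves `(u, v) ↦ (u, u v)` and `(u, v) ↦ (u v, v)`. -/
theorem isConjDescendant_of_isGeneratorPair (τ : Fin 2 → Bool) (l m : List (Fin 2))
    (h : IsGeneratorPair (signedElt τ l) (signedElt τ m)) :
    IsConjDescendant (signedElt τ [0]) (signedElt τ [1]) (signedElt τ l) (signedElt τ m) := by
  induction hn : l.length + m.length using Nat.strong_induction_on generalizing l m with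
  | _ n ih =>
  subst hn
  -- A pair in which one word is a prefix or a suffix of the other is obtained from a shorter pair.
  have hprefix : ∀ l m : List (Fin 2), IsGeneratorPair (signedElt τ l) (signedElt τ (l ++ m)) →
      (∀ k : ℕ, k < l.length + (l ++ m).length → ∀ l m : List (Fin 2),
        IsGeneratorPair (signedElt τ l) (signedElt τ m) → l.length + m.length = k →
        IsConjDescendant (signedElt τ [0]) (signedElt τ [1]) (signedElt τ l) (signedElt τ m)) →
      IsConjDescendant (signedElt τ [0]) (signedElt τ [1]) (signedElt τ l)
        (signedElt τ (l ++ m)) := by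
    intro l m h ih
    have hl := List.length_pos_iff.mpr (ne_nil_of_signedElt_ne_one h.ne_one)
    rw [signedElt_append] at h ⊢
    refine (ih _ ?_ l m ?_ rfl).mul_right
    · simp only [List.length_append]
      omega
    · have h1 : signedElt τ l ∈ Subgroup.closure {signedElt τ l, signedElt τ m} :=
        Subgroup.subset_closure (by simp)
      exact h.of_mem h1 (Subgroup.mul_mem _ h1 (Subgroup.subset_closure (by simp)))
  have hsuffix : ∀ l m : List (Fin 2), IsGeneratorPair (signedElt τ l) (signedElt τ (m ++ l)) →
      (∀ k : ℕ, k < l.length + (m ++ l).length → ∀ l m : List (Fin 2),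
        IsGeneratorPair (signedElt τ l) (signedElt τ m) → l.length + m.length = k →
        IsConjDescendant (signedElt τ [0]) (signedElt τ [1]) (signedElt τ l) (signedElt τ m)) →
      IsConjDescendant (signedElt τ [0]) (signedElt τ [1]) (signedElt τ l)
        (signedElt τ (m ++ l)) := by
    intro l m h ih
    have hl := List.length_pos_iff.mpr (ne_nil_of_signedElt_ne_one h.ne_one)
    rw [signedElt_append] at h ⊢
    refine (ih _ ?_ l m ?_ rfl).mul_left
    · simp only [List.length_append]
      omega
    · have h1 : signedElt τ l ∈ Subgroup.closure {signedElt τ l, signedElt τ m} :=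
        Subgroup.subset_closure (by simp)
      exact h.of_mem h1 (Subgroup.mul_mem _ (Subgroup.subset_closure (by simp)) h1)
  obtain ⟨f, l', m', rfl, rfl, hl' | hm' | ⟨hl', hm', hhead⟩⟩ := List.exists_common_prefix l m
  · subst hl'
    rw [List.append_nil] at *
    exact hprefix f m' h fun k hk l m h hlm => ih k hk l m h hlm
  · subst hm'
    rw [List.append_nil] at *
    exact (hprefix f l' h.symm fun k hk l m h hlm => ih k (by omega) l m h hlm).symm
  · -- Conjugation by the common prefix makes the first letters different.
    have hconj : ∀ k : List (Fin 2),
        signedElt τ f * signedElt τ (k ++ f) * (signedElt τ f)⁻¹ = signedElt τ (f ++ k) := fun k => by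
      rw [signedElt_append, signedElt_append]
      group
    have hconj' : ∀ k : List (Fin 2),
        (signedElt τ f)⁻¹ * signedElt τ (f ++ k) * (signedElt τ f)⁻¹⁻¹ = signedElt τ (k ++ f) :=
      fun k => by
      rw [signedElt_append, signedElt_append]
      group
    have h' := h.conj (signedElt τ f)⁻¹
    rw [hconj', hconj'] at h'
    rw [← hconj l', ← hconj m']
    refine IsConjDescendant.conj _ ?_
    have hlen : (f ++ l').length + (f ++ m').length = (l' ++ f).length + (m' ++ f).length := by
      simp only [List.length_append]
      omega
    have hhead' : (l' ++ f).head? ≠ (m' ++ f).head? := by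
      rwa [List.head?_append_of_ne_nil _ hl', List.head?_append_of_ne_nil _ hm']
    rw [hlen] at ih
    generalize l' ++ f = l at *
    generalize m' ++ f = m at *
    obtain ⟨s, p, q, rfl, rfl, hp | hq | ⟨hp, hq, hlast⟩⟩ := List.exists_common_suffix l m
    · subst hp
      rw [List.nil_append] at *
      exact hsuffix s q h' fun k hk l m h hlm => ih k hk l m h hlm
    · subst hq
      rw [List.nil_append] at *
      exact (hsuffix s p h'.symm fun k hk l m h hlm => ih k (by omega) l m h hlm).symm
    · rw [List.head?_append_of_ne_nil _ hp, List.head?_append_of_ne_nil _ hq] at hhead'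
      obtain ⟨rfl, hP⟩ := eq_letters_of_isGeneratorPair (P := ![p, q]) (s := s) h'
        (by intro i; fin_cases i <;> assumption) hhead' hlast
      rw [List.append_nil, List.append_nil]
      have hletters : (p = [0] ∧ q = [1]) ∨ (p = [1] ∧ q = [0]) := by
        have h0 := hP 0
        have h1 := hP 1
        simp only [Fin.exists_fin_two, Matrix.cons_val_zero, Matrix.cons_val_one] at h0 h1
        rcases h0 with rfl | rfl <;> rcases h1 with h1 | h1 <;> simp_all
      have hrefl : IsConjDescendant (signedElt τ [0]) (signedElt τ [1]) (signedElt τ [0])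
          (signedElt τ [1]) := ⟨_, _, 1, .refl, Or.inl ⟨by simp, by simp⟩⟩
      rcases hletters with ⟨rfl, rfl⟩ | ⟨rfl, rfl⟩
      · exact hrefl
      · exact hrefl.symm

/-- The sign pattern of a positive pair whose exponents of `b` have the sign `σ`. -/
def signPattern (σ : Bool) : Fin 2 → Bool := ![true, σ]

theorem IsPositivePair.exists_isConjDescendant {u v : F2} (h : IsPositivePair u v) :
    ∃ σ, IsConjDescendant (signedElt (signPattern σ) [0]) (signedElt (signPattern σ) [1]) u v := by
  obtain ⟨hgen, ⟨-, hu⟩, ⟨-, hv⟩, σ, hσ⟩ := h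
  refine ⟨σ, ?_⟩
  have key : ∀ w : F2, (∀ x ∈ w.toWord, x.1 = 0 → x.2 = true) → (∀ x ∈ w.toWord, x.1 = 1 → x.2 = σ) →
      w = signedElt (signPattern σ) (w.toWord.map Prod.fst) := by
    intro w h0 h1
    have : signedWord (signPattern σ) (w.toWord.map Prod.fst) = w.toWord := by
      unfold signedWord
      rw [List.map_map]
      refine (List.map_congr_left fun x hx => ?_).trans (List.map_id _)
      obtain ⟨i, b⟩ := x
      have h0' := h0 _ hx
      have h1' := h1 _ hx
      fin_cases i
      · simpa [signPattern] using (h0' rfl).symm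
      · simpa [signPattern] using (h1' rfl).symm
    rw [signedElt, this, FreeGroup.mk_toWord]
  have eu := key u hu fun x hx => hσ x (List.mem_append_left _ hx)
  have ev := key v hv fun x hx => hσ x (List.mem_append_right _ hx)
  rw [eu, ev] at hgen ⊢
  exact isConjDescendant_of_isGeneratorPair _ _ _ hgen

end PositivePairs

/-! ### Infinite branches of generating pairs -/

theorem Matrix.trace_mul_mul_self_left {A B : Matrix (Fin 2) (Fin 2) ℂ} (hA : A.det = 1) :
    (A * (A * B)).trace = A.trace * (A * B).trace - B.trace := by
  rw [Matrix.det_fin_two] at hA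
  simp only [Matrix.trace_fin_two, Matrix.mul_apply, Fin.sum_univ_two]
  linear_combination (-(B 0 0 + B 1 1)) * hA

theorem Matrix.trace_mul_mul_self_right {A B : Matrix (Fin 2) (Fin 2) ℂ} (hB : B.det = 1) :
    (A * B * B).trace = (A * B).trace * B.trace - A.trace := by
  rw [Matrix.det_fin_two] at hB
  simp only [Matrix.trace_fin_two, Matrix.mul_apply, Fin.sum_univ_two]
  linear_combination (-(A 0 0 + A 1 1)) * hB

section Branches

open Filter Topology

variable {ρ : F2 →* Matrix.SpecialLinearGroup (Fin 2) ℂ}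

theorem coe_map_mul (g h : F2) : (ρ (g * h)).1 = (ρ g).1 * (ρ h).1 := by
  rw [map_mul]
  rfl

theorem coe_map_pow (g : F2) (n : ℕ) : (ρ (g ^ n)).1 = (ρ g).1 ^ n := by
  induction n with
  | zero => simp
  | succ n ih => rw [pow_succ, pow_succ, coe_map_mul, ih]

theorem Hyp3.ExpandingPair.conj_map {u v : F2} (g : F2)
    (h : Hyp3.ExpandingPair (ρ u).1 (ρ v).1) :
    Hyp3.ExpandingPair (ρ (g * u * g⁻¹)).1 (ρ (g * v * g⁻¹)).1 := by
  simp only [coe_map_mul]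
  refine h.conj ?_
  rw [← coe_map_mul, inv_mul_cancel, map_one]
  rfl

theorem SatisfiesBQ.trace_ne (hρ : SatisfiesBQ ρ) {u v : F2} (h : IsGeneratorPair u v) :
    ∀ x ∈ Set.Icc (-2 : ℝ) 2, (ρ v).1.trace ≠ (x : ℂ) :=
  hρ.2.1 v ⟨u, h.symm⟩

/-- An infinite branch of the binary tree of generating pairs: at each step one of the two generators
is replaced by the product. The homomorphism `θ` to the integers is positive on the first pair, and
grows along the branch. -/
structure GeneratorBranch (θ : F2 →* Multiplicative ℤ) (u v : ℕ → F2) : Prop where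
  step : ∀ n, (u (n + 1) = u n ∧ v (n + 1) = u n * v n) ∨
    (u (n + 1) = u n * v n ∧ v (n + 1) = v n)
  gen : ∀ n, IsGeneratorPair (u n) (v n)
  pos_left : 0 < (θ (u 0)).toAdd
  pos_right : 0 < (θ (v 0)).toAdd

namespace GeneratorBranch

variable {θ : F2 →* Multiplicative ℤ} {u v : ℕ → F2}

theorem pos (h : GeneratorBranch θ u v) (n : ℕ) :
    0 < (θ (u n)).toAdd ∧ 0 < (θ (v n)).toAdd := by
  induction n with
  | zero => exact ⟨h.pos_left, h.pos_right⟩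
  | succ n ih =>
    rcases h.step n with ⟨e1, e2⟩ | ⟨e1, e2⟩ <;>
    · rw [e1, e2, map_mul, toAdd_mul]
      constructor <;> omega

theorem strictMono (h : GeneratorBranch θ u v) :
    StrictMono fun n => (θ (u n * v n)).toAdd := by
  refine strictMono_nat_of_lt_succ fun n => ?_
  have := h.pos n
  rcases h.step n with ⟨e1, e2⟩ | ⟨e1, e2⟩ <;>
  · simp only [e1, e2, map_mul, toAdd_mul]
    omega

/-- The products along a branch are pairwise inequivalent primitive elements, so the BQ-conditions
leave only finitely many of them with a trace of modulus at most two. -/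
theorem eventually_two_lt_norm_trace (h : GeneratorBranch θ u v) (hρ : SatisfiesBQ ρ) :
    ∀ᶠ n in atTop, 2 < ‖(ρ (u n * v n)).1.trace‖ := by
  have hconj : ∀ g k : F2, IsConj g k → (θ g).toAdd = (θ k).toAdd := by
    intro g k hgk
    obtain ⟨c, rfl⟩ := isConj_iff.mp hgk
    simp
  have hinj : Function.Injective fun n => Quotient.mk extendedConj (u n * v n) := by
    intro m n hmn
    have hrel : IsConj (u m * v m) (u n * v n) ∨ IsConj (u m * v m) (u n * v n)⁻¹ :=
      Quotient.exact hmn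
    apply h.strictMono.injective
    change (θ (u m * v m)).toAdd = (θ (u n * v n)).toAdd
    rcases hrel with hc | hc
    · exact hconj _ _ hc
    · have e := hconj _ _ hc
      have hm := h.pos m
      have hn := h.pos n
      simp only [map_inv, map_mul, toAdd_inv, toAdd_mul] at e
      omega
  have hfin := hρ.2.2.preimage hinj.injOn
  have := hfin.eventually_cofinite_notMem
  rw [Nat.cofinite_eq_atTop] at this
  filter_upwards [this] with n hn
  by_contra! hle
  exact hn ⟨u n * v n, ⟨⟨v n, (h.gen n).mul_left⟩, hle⟩, rfl⟩

theorem shift (h : GeneratorBranch θ u v) (N : ℕ) :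
    GeneratorBranch θ (fun n => u (N + n)) (fun n => v (N + n)) where
  step n := h.step (N + n)
  gen n := h.gen (N + n)
  pos_left := (h.pos N).1
  pos_right := (h.pos N).2

theorem traceStep (n : ℕ) :
    (u (n + 1) = u n ∧ v (n + 1) = u n * v n → TraceStepRight (ρ (u n)).1.trace (ρ (v n)).1.trace
      (ρ (u n * v n)).1.trace (ρ (u (n + 1))).1.trace (ρ (v (n + 1))).1.trace
      (ρ (u (n + 1) * v (n + 1))).1.trace) ∧
    (u (n + 1) = u n * v n ∧ v (n + 1) = v n → TraceStepLeft (ρ (u n)).1.trace (ρ (v n)).1.trace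
      (ρ (u n * v n)).1.trace (ρ (u (n + 1))).1.trace (ρ (v (n + 1))).1.trace
      (ρ (u (n + 1) * v (n + 1))).1.trace) := by
  constructor
  · rintro ⟨e1, e2⟩
    rw [e1, e2]
    refine ⟨rfl, rfl, ?_⟩
    rw [coe_map_mul (u n) (u n * v n), coe_map_mul (u n) (v n)]
    exact Matrix.trace_mul_mul_self_left (ρ (u n)).2
  · rintro ⟨e1, e2⟩
    rw [e1, e2]
    refine ⟨rfl, rfl, ?_⟩
    rw [coe_map_mul (u n * v n) (v n), coe_map_mul (u n) (v n)]
    exact Matrix.trace_mul_mul_self_right (ρ (v n)).2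

/-- A branch which replaces only the first generator: its pairs are `(u vⁿ, v)`. -/
theorem exists_expandingPair_of_left (h : GeneratorBranch θ u v) (hρ : SatisfiesBQ ρ)
    (hleft : ∀ n, u (n + 1) = u n * v n ∧ v (n + 1) = v n) :
    ∃ n, Hyp3.ExpandingPair (ρ (u n)).1 (ρ (v n)).1 := by
  have hform : ∀ n, u n = u 0 * v 0 ^ n ∧ v n = v 0 := by
    intro n
    induction n with
    | zero => simp
    | succ n ih => rw [(hleft n).1, (hleft n).2, ih.1, ih.2, pow_succ, mul_assoc]; simp
  have hmat : ∀ n, (ρ (u n)).1 = (ρ (u 0)).1 * (ρ (v 0)).1 ^ n := fun n => by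
    rw [(hform n).1, coe_map_mul, coe_map_pow]
  have hlarge : ∀ᶠ n in atTop, 2 < ‖((ρ (u 0)).1 * (ρ (v 0)).1 ^ n).trace‖ := by
    rw [← map_add_atTop_eq_nat 1, eventually_map]
    filter_upwards [h.eventually_two_lt_norm_trace hρ] with n hn
    rwa [← hmat, (hleft n).1]
  obtain ⟨n, hn⟩ := Hyp3.ExpandingPair.exists_mul_pow (ρ (u 0)).2 (ρ (v 0)).2
    (hρ.trace_ne (h.gen 0)) hlarge.frequently
  exact ⟨n, by rwa [hmat, (hform n).2]⟩

/-- A branch which replaces only the second generator: its pairs are `(u, uⁿ v)`, which are conjugate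
to `(u, v uⁿ)`. -/
theorem exists_expandingPair_of_right (h : GeneratorBranch θ u v) (hρ : SatisfiesBQ ρ)
    (hright : ∀ n, u (n + 1) = u n ∧ v (n + 1) = u n * v n) :
    ∃ n, Hyp3.ExpandingPair (ρ (u n)).1 (ρ (v n)).1 := by
  have hform : ∀ n, u n = u 0 ∧ v n = u 0 ^ n * v 0 := by
    intro n
    induction n with
    | zero => simp
    | succ n ih => rw [(hright n).1, (hright n).2, ih.1, ih.2, pow_succ', mul_assoc]; simp
  have htrace : ∀ n, ((ρ (v 0)).1 * (ρ (u 0)).1 ^ n).trace = (ρ (v n)).1.trace := fun n => by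
    rw [(hform n).2, coe_map_mul, coe_map_pow, Matrix.trace_mul_comm]
  have hlarge : ∀ᶠ n in atTop, 2 < ‖((ρ (v 0)).1 * (ρ (u 0)).1 ^ n).trace‖ := by
    rw [← map_add_atTop_eq_nat 1, eventually_map]
    filter_upwards [h.eventually_two_lt_norm_trace hρ] with n hn
    rwa [htrace, (hright n).2]
  obtain ⟨n, hn⟩ := Hyp3.ExpandingPair.exists_mul_pow (ρ (v 0)).2 (ρ (u 0)).2
    (hρ.trace_ne (h.gen 0).symm) hlarge.frequently
  rw [← coe_map_pow, ← coe_map_mul] at hn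
  have hn' := (hn.conj_map (u 0 ^ n)).symm
  have e1 : u 0 ^ n * u 0 * (u 0 ^ n)⁻¹ = u n := by rw [(hform n).1]; group
  have e2 : u 0 ^ n * (v 0 * u 0 ^ n) * (u 0 ^ n)⁻¹ = v n := by rw [(hform n).2]; group
  rw [e1, e2] at hn'
  exact ⟨n, hn'⟩

/-- A branch which replaces both generators infinitely often: the traces tend to infinity. -/
theorem exists_expandingPair_of_frequently (h : GeneratorBranch θ u v) (hρ : SatisfiesBQ ρ)
    (hright : ∃ᶠ n in atTop, u (n + 1) = u n ∧ v (n + 1) = u n * v n)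
    (hleft : ∃ᶠ n in atTop, u (n + 1) = u n * v n ∧ v (n + 1) = v n) :
    ∃ n, Hyp3.ExpandingPair (ρ (u n)).1 (ρ (v n)).1 := by
  set x : ℕ → ℂ := fun n => (ρ (u n)).1.trace with hx
  set y : ℕ → ℂ := fun n => (ρ (v n)).1.trace with hy
  set z : ℕ → ℂ := fun n => (ρ (u n * v n)).1.trace with hz
  have step : ∀ n, TraceStepRight (x n) (y n) (z n) (x (n + 1)) (y (n + 1)) (z (n + 1)) ∨
      TraceStepLeft (x n) (y n) (z n) (x (n + 1)) (y (n + 1)) (z (n + 1)) :=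
    fun n => (h.step n).imp (traceStep n).1 (traceStep n).2
  have right := hright.mono fun n => (traceStep (ρ := ρ) (u := u) (v := v) n).1
  have left := hleft.mono fun n => (traceStep (ρ := ρ) (u := u) (v := v) n).2
  have hzlarge := h.eventually_two_lt_norm_trace hρ
  have hxylarge := eventually_le_norm_of_steps step right left (S := {w | 2 < ‖w‖}) hzlarge
  obtain ⟨N, hN⟩ := eventually_atTop.mp (hzlarge.and hxylarge)
  set μ := x N ^ 2 + y N ^ 2 + z N ^ 2 - x N * y N * z N with hμ
  have hμ4 : μ ≠ 4 := trace_fricke_ne_four hρ.1 (h.gen N) (hρ.trace_ne (h.gen N))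
  have hfreq : ∀ {p : ℕ → Prop}, (∃ᶠ n in atTop, p n) → ∃ᶠ n in atTop, p (N + n) := by
    intro p hp
    rw [frequently_atTop] at hp ⊢
    intro k
    obtain ⟨m, hm, hpm⟩ := hp (N + k)
    exact ⟨m - N, by omega, by rwa [Nat.add_sub_cancel' (by omega)]⟩
  have hbranch : TraceBranch μ (fun n => x (N + n)) (fun n => y (N + n)) (fun n => z (N + n)) :=
    { step := fun n => step (N + n)
      right := hfreq right
      left := hfreq left
      fricke := by
        intro n
        induction n with
        | zero => rfl
        | succ n ih =>
          rcases step (N + n) with ⟨e1, e2, e3⟩ | ⟨e1, e2, e3⟩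
          · rw [← add_assoc, e1, e2, e3, ← ih]
            ring
          · rw [← add_assoc, e1, e2, e3, ← ih]
            ring
      norm_left := fun n => (hN (N + n) (by omega)).2.1
      norm_right := fun n => (hN (N + n) (by omega)).2.2
      norm_prod := fun n => (hN (N + n) (by omega)).1 }
  obtain ⟨n, h1, h2, h3⟩ := hbranch.exists_large hμ4 (max 100 ‖μ‖)
  refine ⟨N + n, Hyp3.ExpandingPair.of_large_traces (ρ (u (N + n))).2 (ρ (v (N + n))).2 rfl rfl ?_
    (hbranch.fricke n) (le_max_left _ _) (le_max_right _ _) h1 h2 h3⟩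
  rw [← coe_map_mul]

theorem exists_expandingPair (h : GeneratorBranch θ u v) (hρ : SatisfiesBQ ρ) :
    ∃ n, Hyp3.ExpandingPair (ρ (u n)).1 (ρ (v n)).1 := by
  by_cases hright : ∃ᶠ n in atTop, u (n + 1) = u n ∧ v (n + 1) = u n * v n
  · by_cases hleft : ∃ᶠ n in atTop, u (n + 1) = u n * v n ∧ v (n + 1) = v n
    · exact h.exists_expandingPair_of_frequently hρ hright hleft
    · obtain ⟨N, hN⟩ := eventually_atTop.mp (not_frequently.mp hleft)
      obtain ⟨n, hn⟩ := (h.shift N).exists_expandingPair_of_right hρ fun n =>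
        (h.step (N + n)).resolve_right (hN (N + n) (by omega))
      exact ⟨N + n, hn⟩
  · obtain ⟨N, hN⟩ := eventually_atTop.mp (not_frequently.mp hright)
    obtain ⟨n, hn⟩ := (h.shift N).exists_expandingPair_of_left hρ fun n =>
      (h.step (N + n)).resolve_left (hN (N + n) (by omega))
    exact ⟨N + n, hn⟩

end GeneratorBranch

/-! ### Long positive pairs are expanding -/

/-- Each descendant of `(a, b)` is an expanding pair or consists of elements of translation length at
most `L`. -/
def DescendantsBoundedBy (ρ : F2 →* Matrix.SpecialLinearGroup (Fin 2) ℂ) (a b : F2) (L : ℝ) : Prop :=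
  ∀ u v, IsDescendant a b u v → Hyp3.ExpandingPair (ρ u).1 (ρ v).1 ∨
    max (Hyp3.translationLength (ρ u)) (Hyp3.translationLength (ρ v)) ≤ L

theorem exists_descendantsBoundedBy_of_children {a b : F2}
    (h1 : ∃ L, DescendantsBoundedBy ρ a (a * b) L) (h2 : ∃ L, DescendantsBoundedBy ρ (a * b) b L) :
    ∃ L, DescendantsBoundedBy ρ a b L := by
  obtain ⟨L₁, h1⟩ := h1
  obtain ⟨L₂, h2⟩ := h2
  refine ⟨max (max (Hyp3.translationLength (ρ a)) (Hyp3.translationLength (ρ b))) (max L₁ L₂),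
    fun u v huv => ?_⟩
  rcases huv.eq_or_child with ⟨rfl, rfl⟩ | h | h
  · exact Or.inr (le_max_left _ _)
  · exact (h1 u v h).imp_right fun h => h.trans ((le_max_left _ _).trans (le_max_right _ _))
  · exact (h2 u v h).imp_right fun h => h.trans ((le_max_right _ _).trans (le_max_right _ _))

theorem Hyp3.ExpandingPair.of_isDescendant {a b u v : F2} (h : IsDescendant a b u v)
    (hab : Hyp3.ExpandingPair (ρ a).1 (ρ b).1) : Hyp3.ExpandingPair (ρ u).1 (ρ v).1 := by
  induction h with
  | refl => exact hab
  | right _ ih => rw [coe_map_mul]; exact ih.mul_right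
  | left _ ih => rw [coe_map_mul]; exact ih.mul_left

/-- The descendants of a generating pair that fail to be expanding have bounded translation lengths.
Otherwise there is, as in König's lemma, an infinite branch of pairs for which this fails; by heredity
none of these pairs is expanding. -/
theorem SatisfiesBQ.exists_descendantsBoundedBy (hρ : SatisfiesBQ ρ) {a b : F2}
    (hab : IsGeneratorPair a b) (θ : F2 →* Multiplicative ℤ) (ha : 0 < (θ a).toAdd)
    (hb : 0 < (θ b).toAdd) : ∃ L, DescendantsBoundedBy ρ a b L := by
  by_contra hneg
  let S := {p : F2 × F2 // IsGeneratorPair p.1 p.2 ∧ ¬ ∃ L, DescendantsBoundedBy ρ p.1 p.2 L}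
  have hnext : ∀ p : S, ∃ q : S, (q.1.1 = p.1.1 ∧ q.1.2 = p.1.1 * p.1.2) ∨
      (q.1.1 = p.1.1 * p.1.2 ∧ q.1.2 = p.1.2) := by
    rintro ⟨⟨u, v⟩, hgen, hp⟩
    by_cases h1 : ∃ L, DescendantsBoundedBy ρ u (u * v) L
    · exact ⟨⟨(u * v, v), hgen.mul_left, fun h2 =>
        hp (exists_descendantsBoundedBy_of_children h1 h2)⟩, Or.inr ⟨rfl, rfl⟩⟩
    · exact ⟨⟨(u, u * v), hgen.mul_right, h1⟩, Or.inl ⟨rfl, rfl⟩⟩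
  choose next hnext using hnext
  let s : ℕ → S := fun n => next^[n] ⟨(a, b), hab, hneg⟩
  have hs : ∀ n, s (n + 1) = next (s n) := fun n => Function.iterate_succ_apply' next n _
  have hbranch : GeneratorBranch θ (fun n => (s n).1.1) (fun n => (s n).1.2) :=
    { step := fun n => by simpa only [hs] using hnext (s n)
      gen := fun n => (s n).2.1
      pos_left := ha
      pos_right := hb }
  obtain ⟨n, hn⟩ := hbranch.exists_expandingPair hρ
  exact (s n).2.2 ⟨0, fun u v huv => Or.inl (hn.of_isDescendant huv)⟩

end Branches

theorem isGeneratorPair_letters (σ : Bool) :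
    IsGeneratorPair (signedElt (signPattern σ) [0]) (signedElt (signPattern σ) [1]) := by
  have h : IsGeneratorPair (FreeGroup.of 0) (FreeGroup.of 1) := by
    unfold IsGeneratorPair
    rw [← FreeGroup.closure_range_of]
    congr 1
    ext x
    simp [Fin.exists_fin_two, eq_comm]
  refine h.of_mem (Subgroup.subset_closure (Or.inl rfl)) ?_
  have h1 : signedElt (signPattern σ) [1] ∈ Subgroup.closure
      {signedElt (signPattern σ) [0], signedElt (signPattern σ) [1]} :=
    Subgroup.subset_closure (Or.inr rfl)
  cases σ
  · simpa [signedElt, signedWord, signPattern, FreeGroup.inv_mk, FreeGroup.of,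
      FreeGroup.invRev] using
      Subgroup.inv_mem _ h1
  · exact h1

/-- The homomorphism that counts the letters of a word whose signs are those of the pattern. -/
def signedLength (σ : Bool) : F2 →* Multiplicative ℤ :=
  FreeGroup.lift fun i => Multiplicative.ofAdd (if signPattern σ i then 1 else -1)

theorem signedLength_letter (σ : Bool) (i : Fin 2) :
    0 < (signedLength σ (signedElt (signPattern σ) [i])).toAdd := by
  cases σ <;> fin_cases i <;> decide

theorem mainTheorem4 (ρ : F2 →* Matrix.SpecialLinearGroup (Fin 2) ℂ) (hρ : SatisfiesBQ ρ) :
    ∃ L₂ : ℝ, 0 < L₂ ∧ ∀ u v : F2, IsPositivePair u v →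
      L₂ < max (Hyp3.translationLength (ρ u)) (Hyp3.translationLength (ρ v)) →
      ∀ O : Hyp3, ∃ K ε : ℝ, 0 < K ∧ 0 < ε ∧
        ∀ w ∈ positiveWords, Hyp3.IsQuasigeodesic K ε (brokenGeodesic ρ O u v w) := by
  choose L hL using fun σ => hρ.exists_descendantsBoundedBy (isGeneratorPair_letters σ)
    (signedLength σ) (signedLength_letter σ 0) (signedLength_letter σ 1)
  refine ⟨max 1 (max (L true) (L false)), by positivity, fun u v huv hlong O => ?_⟩
  refine Hyp3.ExpandingPair.exists_isQuasigeodesic_brokenGeodesic ?_ O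
  obtain ⟨σ, x, y, g, hxy, hconj⟩ := huv.exists_isConjDescendant
  have hlen : ∀ w, Hyp3.translationLength (ρ (g * w * g⁻¹)) = Hyp3.translationLength (ρ w) :=
    fun w => by rw [map_mul, map_mul, map_inv, Hyp3.translationLength_conj]
  have hLσ : L σ ≤ max 1 (max (L true) (L false)) := by
    cases σ
    · exact (le_max_right _ _).trans (le_max_right _ _)
    · exact (le_max_left _ _).trans (le_max_right _ _)
  have hexp : Hyp3.ExpandingPair (ρ x).1 (ρ y).1 := by
    refine (hL σ x y hxy).resolve_right fun h => ?_
    rcases hconj with ⟨rfl, rfl⟩ | ⟨rfl, rfl⟩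
    · rw [hlen, hlen] at hlong
      linarith
    · rw [hlen, hlen, max_comm (Hyp3.translationLength (ρ y))] at hlong
      linarith
  rcases hconj with ⟨rfl, rfl⟩ | ⟨rfl, rfl⟩
  · exact hexp.conj_map g
  · exact hexp.symm.conj_map g
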